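/- Let $p\ge 7$ be a prime. For $1\le a\le p-1$ let $q_a=\frac{a^{p-1}-1}{p}$ be the Fermat quotient, let $w_p=\frac{(p-1)!+1}{p}$ be the Wilson quotient, let $B_k$ be the Bernoulli numbers, $\mathfrak{B}_k=B_k/k$ ($k\ge 1$) the divided Bernoulli numbers, $\mathcal{C}\mathfrak{B}(p-1)=\sum_{i=2}^{p-3}\mathfrak{B}_i\mathfrak{B}_{p-1-i}$, and let $(pB_{p-1})_1:=\frac{1+pB_{p-1}}{p}$ be the Agoh–Giuga quotient. Apart from this last notation, for a $p$-adic integer $x$ we write $(x)_i\in\{0,\dots,p-1\}$ for the digits of its expansion $x=\sum_{i\ge 0}(x)_ip^i$. Congruences modulo $p$ are between rational numbers that are $p$-adic integers. Empty sums are $0$. All the numbers to which $(\cdot)_i$ is applied below as a digit are $p$-adic integers, and the following holds. (General case.) For every integer $n$ with $2\le 2n\le p-5$, $$\begin{aligned}\sum_{a=1}^{p-1}\frac{q_a^3}{a^{2n}}\equiv{}&-2\sum_{i=2}^{p-5-2n}\mathfrak{B}_i\,(\mathfrak{B}_{2(p-1)-2n-i}-\mathfrak{B}_{p-1-2n-i})_1+2w_p\,(\mathfrak{B}_{2(p-1)-2n}-\mathfrak{B}_{p-1-2n})_1\\&-\bigl(1+2(\mathfrak{B}_{p+1}-\mathfrak{B}_2)_1\bigr)\mathfrak{B}_{p-3-2n}-\bigl(w_p^2+\mathcal{C}\mathfrak{B}(p-1)\bigr)\mathfrak{B}_{p-1-2n}\\&-2\sum_{i=p+1-2n}^{p-3}\mathfrak{B}_i\,(\mathfrak{B}_{3(p-1)-2n-i}-\mathfrak{B}_{2(p-1)-2n-i})_1\pmod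 p\end{aligned}$$ and $$\sum_{a=1}^{p-1}\frac{q_a^3}{a^{2n}}\equiv\frac{pB_{4(p-1)-2n}-3pB_{3(p-1)-2n}+3pB_{2(p-1)-2n}-pB_{p-1-2n}}{p^3}-\mathfrak{B}_{p-3-2n}\pmod p.$$ Moreover, $$w_p\equiv (pB_{p-1})_1-1\pmod p,\qquad \mathcal{C}\mathfrak{B}(p-1)\equiv\bigl(2p\,\mathfrak{B}_{2(p-1)}-p^2\mathfrak{B}_{p-1}^2\bigr)_2\pmod p.$$ (Case $2n=0$.) $$\sum_{a=1}^{p-1}q_a^3\equiv-\bigl(1+2(\mathfrak{B}_{p+1}-\mathfrak{B}_2)_1\bigr)\mathfrak{B}_{p-3}+w_p\bigl(w_p^2+\mathcal{C}\mathfrak{B}(p-1)\bigr)-2\sum_{k=2}^{p-5}\mathfrak{B}_k\,(\mathfrak{B}_{2(p-1)-k}-\mathfrak{B}_{p-1-k})_1\pmod p$$ and $$\sum_{a=1}^{p-1}q_a^3\equiv\frac{pB_{3(p-1)}-3pB_{2(p-1)}+3pB_{p-1}-p+1}{p^3}-\mathfrak{B}_{p-3}\pmod p.$$ -/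

import Mathlib

open Finset

noncomputable section

/-- The rational number `x` is a `p`-adic integer. -/
def IsPInt (p : ℕ) [Fact p.Prime] (x : ℚ) : Prop :=
  ‖(x : ℚ_[p])‖ ≤ 1

/-- Congruence modulo `p` between rational numbers: both are `p`-adic integers and
they are congruent modulo `p` in `ℤ_[p]`. -/
def CongrModP (p : ℕ) [Fact p.Prime] (x y : ℚ) : Prop :=
  ∃ u v : ℤ_[p], (u : ℚ_[p]) = (x : ℚ_[p]) ∧ (v : ℚ_[p]) = (y : ℚ_[p]) ∧ (p : ℤ_[p]) ∣ u - v

/-- The digits of the Hensel expansion `x = ∑ (x)_i p ^ i`, `0 ≤ (x)_i < p`, of a `p`-adic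
integer.  (`x.appr k` is the natural number below `p ^ k` congruent to `x` modulo `p ^ k`.) -/
def henselDigit (p : ℕ) [Fact p.Prime] (x : ℤ_[p]) (i : ℕ) : ℕ :=
  x.appr (i + 1) / p ^ i

theorem henselDigit_lt (p : ℕ) [Fact p.Prime] (x : ℤ_[p]) (i : ℕ) : henselDigit p x i < p := by
  unfold henselDigit
  rw [Nat.div_lt_iff_lt_mul (pow_pos (Fact.out : p.Prime).pos i), mul_comm, ← pow_succ]
  exact x.appr_lt (i + 1)

theorem sum_henselDigit (p : ℕ) [Fact p.Prime] (x : ℤ_[p]) (k : ℕ) :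
    ∑ i ∈ range k, henselDigit p x i * p ^ i = x.appr k := by
  induction k with
  | zero => simp [PadicInt.appr]
  | succ k ih =>
    rw [sum_range_succ, ih]
    have hdvd : p ^ k ∣ x.appr (k + 1) - x.appr k := x.dvd_appr_sub_appr k (k + 1) (Nat.le_succ k)
    have hle : x.appr k ≤ x.appr (k + 1) := x.appr_mono (Nat.le_succ k)
    obtain ⟨c, hc⟩ := hdvd
    have hlt := x.appr_lt k
    have hpos : 0 < p ^ k := pow_pos (Fact.out : p.Prime).pos k
    have h1 : x.appr (k + 1) = x.appr k + p ^ k * c := by omega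
    unfold henselDigit
    rw [h1, Nat.add_mul_div_left _ _ hpos, Nat.div_eq_of_lt hlt]
    ring

open Classical in
/-- The Hensel digit `(x)_i` of a rational number `x` that is a `p`-adic integer
(and `0` if `x` is not a `p`-adic integer). -/
def hres (p : ℕ) [Fact p.Prime] (x : ℚ) (i : ℕ) : ℚ :=
  if h : IsPInt p x then (henselDigit p ⟨(x : ℚ_[p]), h⟩ i : ℚ) else 0

/-- The divided Bernoulli number `B_t / t`. -/
def dB (t : ℕ) : ℚ := bernoulli t / t

/-- The convolution of divided Bernoulli numbers of order `m`. -/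
def convB (m : ℕ) : ℚ := ∑ i ∈ Icc 2 (m - 2), dB i * dB (m - i)

/-- The Fermat quotient of `p` in base `a`. -/
def fermatQ (p a : ℕ) : ℚ := ((a : ℚ) ^ (p - 1) - 1) / p

/-- The Wilson quotient. -/
def wilsonQ (p : ℕ) : ℚ := ((Nat.factorial (p - 1) : ℚ) + 1) / p

/-- The Agoh-Giuga quotient. -/
def agohGiugaQ (p : ℕ) : ℚ := (1 + p * bernoulli (p - 1)) / p

end

namespace FermatQuotientSums

/-! ### Teichmüller representatives, moments and finite Fourier inversion -/

section Teichmuller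

variable (p : ℕ) [hpr : Fact p.Prime]

/-! For 0 < a < p write a = ω(a)(1 + p t_a), with ω the Teichmüller character. Then a^(p-1) = (1 + p
t_a)^(p-1), so q_a ≡ -t_a mod p, and the cubic sums become -V_3(p-1-2n), where V_k(m) = ∑ ω^m t^k
mod p depends on m only modulo p-1.

The moments V_1 and V_2 are Bernoulli data. The power sum S_m = ∑ a^m is expanded binomially in p t
(`sum_pow_eq_U`) and by Faulhaber's formula (`sum_range_pow_eq`). Comparing the two after division
by m p (`dB_modEq`) gives 𝔅_m ≡ V_1(m) for even m not divisible by p-1 (`red_dB`), and (𝔅_{m+p-1} -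
𝔅_m)/p ≡ -V_2(m)/2 if moreover m ≥ 4 and p-1 does not divide m-2 (`red_dB_sub`). At m = 2 the
nonzero B_1 adds -1/4 (`red_dB_sub_two`). The Wilson quotient is -V_1(0).

First congruence: by orthogonality of characters, V_{k+1}(m) = -∑_i V_1(i) V_k(m-i) (`V_succ`). The
case k = 2 is the stated convolution; k = 1, m = 0 evaluates V_2(0) (`V_two_zero`).

Second congruence: the third difference of S_m with step p-1 is p^3 ∑ a^m q_a^3, while S_m ≡ p B_m +
p^3 C(m,3) 𝔅_{m-2} mod p^4 (`sum_pow_even_modEq`). The third difference of C(m,3) is constant, which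
leaves one term 𝔅_{m-2}. -/

theorem toZMod_eq_constantCoeff (z : ℤ_[p]) :
    PadicInt.toZMod z = WittVector.constantCoeff (WittVector.fromPadicInt p z) := by
  have h := PadicInt.toZMod_spec z
  rw [PadicInt.maximalIdeal_eq_span_p, Ideal.mem_span_singleton] at h
  obtain ⟨c, hc⟩ := h
  -- A ring map to `ZMod p` is determined on a natural number plus a multiple of p, so this form
  -- forces the two sides to agree.
  have hz : z = ((PadicInt.toZMod z).val : ℤ_[p]) + p * c := by
    rw [← hc, ZMod.natCast_val]; ring
  conv_rhs => rw [hz]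
  rw [map_add, map_add, map_mul, map_mul, map_natCast, map_natCast, map_natCast, map_natCast,
    CharP.cast_eq_zero (ZMod p) p, zero_mul, add_zero, ZMod.natCast_zmod_val]

/-- The Teichmüller character with values in the `p`-adic integers. -/
noncomputable def teich : (ZMod p)ˣ →* ℤ_[p] :=
  ((WittVector.toPadicInt p : WittVector p (ZMod p) →* ℤ_[p]).comp
    (WittVector.teichmuller p)).comp (Units.coeHom (ZMod p))

theorem toZMod_teich (x : (ZMod p)ˣ) : PadicInt.toZMod (teich p x) = (x : ZMod p) := by
  rw [toZMod_eq_constantCoeff]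
  have h := WittVector.fromPadicInt_comp_toPadicInt_ext p (WittVector.teichmuller p (x : ZMod p))
  simp only [RingHom.comp_apply, RingHom.id_apply] at h
  change WittVector.constantCoeff (WittVector.fromPadicInt p
    (WittVector.toPadicInt p (WittVector.teichmuller p (x : ZMod p)))) = _
  rw [h]
  exact WittVector.teichmuller_coeff_zero p _

theorem toZMod_eq_zero_iff (z : ℤ_[p]) : PadicInt.toZMod z = 0 ↔ ∃ c, z = p * c := by
  rw [← RingHom.mem_ker, PadicInt.ker_toZMod, PadicInt.maximalIdeal_eq_span_p,
    Ideal.mem_span_singleton]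
  rfl

/-- Both sides have the same residue, so they differ by some p c; the value of ω is a unit with
inverse ω(x⁻¹), which can be factored out. -/
theorem exists_teich_quotient (x : (ZMod p)ˣ) :
    ∃ t : ℤ_[p], (((x : ZMod p).val : ℕ) : ℤ_[p]) = teich p x * (1 + p * t) := by
  obtain ⟨c, hc⟩ := (toZMod_eq_zero_iff p ((((x : ZMod p).val : ℕ) : ℤ_[p]) - teich p x)).1
    (by rw [map_sub, toZMod_teich, map_natCast, ZMod.natCast_zmod_val, sub_self])
  refine ⟨teich p x⁻¹ * c, ?_⟩
  have h1 : teich p x * teich p x⁻¹ = 1 := by rw [← map_mul]; simp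
  linear_combination hc - p * c * h1

/-- The `p`-adic integer `t` with `a = teich a * (1 + p * t)` for the representative `a < p`. -/
noncomputable def tq (x : (ZMod p)ˣ) : ℤ_[p] := (exists_teich_quotient p x).choose

theorem val_eq_teich_mul (x : (ZMod p)ˣ) :
    (((x : ZMod p).val : ℕ) : ℤ_[p]) = teich p x * (1 + p * tq p x) :=
  (exists_teich_quotient p x).choose_spec

/-- The moments `∑ teich x ^ m * t x ^ k`. -/
noncomputable def U (k m : ℕ) : ℤ_[p] := ∑ x : (ZMod p)ˣ, teich p x ^ m * tq p x ^ k

/-- The moments modulo `p`. -/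
noncomputable def V (k m : ℕ) : ZMod p := PadicInt.toZMod (U p k m)

/-- The Teichmüller quotients modulo `p`. -/
noncomputable def tau (x : (ZMod p)ˣ) : ZMod p := PadicInt.toZMod (tq p x)

theorem V_eq (k m : ℕ) : V p k m = ∑ x : (ZMod p)ˣ, (x : ZMod p) ^ m * tau p x ^ k := by
  simp [V, U, tau, toZMod_teich]

theorem teich_pow_sub_one (x : (ZMod p)ˣ) : teich p x ^ (p - 1) = 1 := by
  rw [← map_pow, ZMod.units_pow_card_sub_one_eq_one, map_one]

theorem U_add (k m : ℕ) : U p k (m + (p - 1)) = U p k m := by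
  simp [U, pow_add, teich_pow_sub_one]

theorem U_mul (k j : ℕ) : U p k (j * (p - 1)) = U p k 0 := by
  simp [U, mul_comm j, pow_mul, teich_pow_sub_one]

theorem V_add (k : ℕ) {a b : ℕ} (h : a = b + (p - 1)) : V p k a = V p k b := by
  rw [h, V, U_add, V]

theorem U_zero_zero : U p 0 0 = p - 1 := by
  have h := hpr.out.one_le
  simp [U, ZMod.card_units_eq_totient, Nat.totient_prime hpr.out, Nat.cast_sub h]

/-- Orthogonality: ω reduces to the identity, so ω^m is trivial only if every unit of `ZMod p` has
m-th power 1, that is, if p-1 divides m. -/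
theorem U_zero {m : ℕ} (hm : ¬ (p - 1) ∣ m) : U p 0 m = 0 := by
  have h := sum_hom_units_eq_zero ((powMonoidHom m).comp (teich p)) (by
    intro h
    apply hm
    have h1 := (FiniteField.forall_pow_eq_one_iff (ZMod p) m).1 (fun x => by
      have h2 : teich p x ^ m = 1 := by simpa using DFunLike.congr_fun h x
      have h3 := congrArg PadicInt.toZMod h2
      rw [map_pow, toZMod_teich, map_one] at h3
      ext
      simpa using h3)
    rwa [ZMod.card] at h1)
  simpa [U] using h

theorem prod_Icc_eq_prod_units {M : Type*} [CommMonoid M] (f : ℕ → M) :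
    ∏ a ∈ Icc 1 (p - 1), f a = ∏ x : (ZMod p)ˣ, f (x : ZMod p).val := by
  have hlt := hpr.out.one_lt
  refine prod_bij' (fun a ha => Units.mk0 (a : ZMod p) ?_) (fun x _ => (x : ZMod p).val)
    (fun _ _ => mem_univ _) ?_ ?_ ?_ ?_
  · rw [Ne, ZMod.natCast_eq_zero_iff]
    rw [mem_Icc] at ha
    exact Nat.not_dvd_of_pos_of_lt (by omega) (by omega)
  · intro x _
    have h1 := ZMod.val_lt (x : ZMod p)
    have h2 : (x : ZMod p).val ≠ 0 := by simp
    rw [mem_Icc]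
    omega
  · intro a ha
    rw [mem_Icc] at ha
    simp [ZMod.val_natCast_of_lt (show a < p by omega)]
  · intro x _
    ext
    simp
  · intro a ha
    rw [mem_Icc] at ha
    simp [ZMod.val_natCast_of_lt (show a < p by omega)]

theorem sum_Icc_eq_sum_units {M : Type*} [AddCommMonoid M] (f : ℕ → M) :
    ∑ a ∈ Icc 1 (p - 1), f a = ∑ x : (ZMod p)ˣ, f (x : ZMod p).val :=
  prod_Icc_eq_prod_units (M := Multiplicative M) p f

theorem sum_pow_eq_U (m : ℕ) :
    ∑ a ∈ Icc 1 (p - 1), (a : ℤ_[p]) ^ m =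
      ∑ k ∈ range (m + 1), (m.choose k : ℤ_[p]) * p ^ k * U p k m := by
  rw [sum_Icc_eq_sum_units p (fun a => (a : ℤ_[p]) ^ m)]
  simp only [U, mul_sum]
  rw [sum_comm]
  refine sum_congr rfl fun x _ => ?_
  rw [val_eq_teich_mul, mul_pow, add_comm, add_pow, mul_sum]
  refine sum_congr rfl fun k _ => ?_
  rw [mul_pow]
  ring

/-- The sum of y^i over a period is p-1 = -1 at y = 1 and 0 elsewhere, a delta function up to the
sign. -/
theorem tau_fourier (x : (ZMod p)ˣ) :
    tau p x = -∑ i ∈ range (p - 1), V p 1 i * ((x⁻¹ : (ZMod p)ˣ) : ZMod p) ^ i := by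
  have key : ∀ y : (ZMod p)ˣ, ∑ i ∈ range (p - 1), (y : ZMod p) ^ i =
      if y = 1 then -1 else 0 := by
    intro y
    split_ifs with h
    · subst h
      simp [Nat.cast_sub hpr.out.one_le]
    · have h1 : (y : ZMod p) - 1 ≠ 0 := by
        rw [sub_ne_zero]; intro h2; apply h; ext; simpa using h2
      have h2 := mul_geom_sum (y : ZMod p) (p - 1)
      rw [← Units.val_pow_eq_pow_val, ZMod.units_pow_card_sub_one_eq_one] at h2
      simp only [Units.val_one, sub_self, mul_eq_zero] at h2
      exact h2.resolve_left h1
  have h : ∑ i ∈ range (p - 1), V p 1 i * ((x⁻¹ : (ZMod p)ˣ) : ZMod p) ^ i =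
      ∑ y : (ZMod p)ˣ, tau p y * ∑ i ∈ range (p - 1), ((y * x⁻¹ : (ZMod p)ˣ) : ZMod p) ^ i := by
    simp only [V_eq, sum_mul, mul_sum]
    rw [sum_comm]
    refine sum_congr rfl fun y _ => sum_congr rfl fun i _ => ?_
    push_cast
    rw [mul_pow]
    ring
  rw [h]
  simp only [key, mul_inv_eq_one]
  simp

/-- Finite Fourier inversion: one factor `t` is expanded in characters. -/
theorem V_succ (k m : ℕ) :
    V p (k + 1) m = -∑ i ∈ range (p - 1), V p 1 i * V p k (m + (p - 1) - i) := by
  have h : V p (k + 1) m = ∑ x : (ZMod p)ˣ, (x : ZMod p) ^ m * tau p x ^ k *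
      (-∑ i ∈ range (p - 1), V p 1 i * ((x⁻¹ : (ZMod p)ˣ) : ZMod p) ^ i) := by
    rw [V_eq]
    refine sum_congr rfl fun x _ => ?_
    rw [← tau_fourier]
    ring
  rw [h]
  simp only [mul_neg, sum_neg_distrib, mul_sum]
  rw [sum_comm]
  refine congrArg _ (sum_congr rfl fun i hi => ?_)
  rw [V_eq p k, mul_sum]
  refine sum_congr rfl fun x _ => ?_
  -- The extra period p-1 in the exponent keeps the natural subtraction of i < p-1 from truncating.
  have h1 : (x : ZMod p) ^ m * ((x⁻¹ : (ZMod p)ˣ) : ZMod p) ^ i =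
      (x : ZMod p) ^ (m + (p - 1) - i) := by
    rw [mem_range] at hi
    have h2 : (x : (ZMod p)ˣ) ^ m * x⁻¹ ^ i = x ^ (m + (p - 1) - i) := by
      have h3 : x ^ (m + (p - 1) - i) * x ^ i = x ^ m := by
        rw [← pow_add, Nat.sub_add_cancel (by omega), pow_add,
          ZMod.units_pow_card_sub_one_eq_one, mul_one]
      rw [← h3, mul_assoc, ← mul_pow, mul_inv_cancel, one_pow, mul_one]
    exact_mod_cast congrArg (Units.val) h2
  rw [← h1]
  ring

/-- Used for (p-1)! and, with a constant family, for (1 + p t)^(p-1). -/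
theorem exists_prod_one_add {R ι : Type*} [CommRing R] (q : R) (s : Finset ι) (t : ι → R) :
    ∃ z, ∏ x ∈ s, (1 + q * t x) = 1 + q * ∑ x ∈ s, t x + q ^ 2 * z := by
  classical
  induction s using Finset.induction_on with
  | empty => exact ⟨0, by simp⟩
  | insert a s ha ih =>
    obtain ⟨z, hz⟩ := ih
    refine ⟨z + t a * ∑ x ∈ s, t x + q * t a * z, ?_⟩
    rw [prod_insert ha, sum_insert ha, hz]
    ring

theorem teich_neg_one (hp : p ≠ 2) : teich p (-1) = -1 := by
  have h : teich p (-1) ^ 2 = 1 := by rw [← map_pow]; simp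
  rcases mul_self_eq_one_iff.1 ((sq (teich p (-1))).symm.trans h) with h | h
  · have h1 := toZMod_teich p (-1)
    rw [h, map_one] at h1
    have : Fact (2 < p) := ⟨lt_of_le_of_ne hpr.out.two_le hp.symm⟩
    exact absurd h1.symm (by simpa using ZMod.neg_one_ne_one)
  · exact h

/-- Wilson's theorem to second order: the factors ω(a) multiply to ω(-1) = -1, and the factors 1 + p
t_a contribute p ∑ t_a. -/
theorem factorial_eq_U (hp : p ≠ 2) :
    ∃ z : ℤ_[p], ((p - 1).factorial : ℤ_[p]) + 1 = -p * U p 1 0 + p ^ 2 * z := by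
  obtain ⟨z, hz⟩ := exists_prod_one_add (p : ℤ_[p]) univ (tq p)
  refine ⟨-z, ?_⟩
  have h1 : ((p - 1).factorial : ℤ_[p]) = ∏ a ∈ Icc 1 (p - 1), (a : ℤ_[p]) := by
    rw [← Finset.prod_Ico_id_eq_factorial, Finset.Ico_add_one_right_eq_Icc, Nat.cast_prod]
  have h2 : ∏ x : (ZMod p)ˣ, teich p x = -1 := by
    rw [← map_prod, FiniteField.prod_univ_units_id_eq_neg_one, teich_neg_one p hp]
  rw [h1, prod_Icc_eq_prod_units p (fun a => (a : ℤ_[p]))]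
  simp only [val_eq_teich_mul]
  rw [prod_mul_distrib, h2, hz, U]
  simp
  ring

end Teichmuller

/-! ### Faulhaber's formula compared with the moments -/

section Bernoulli

/-- The N padding terms have zero binomial coefficient; they let a fixed number of leading terms be
split off whatever m is. -/
theorem sum_range_pow_eq (p m N : ℕ) :
    (∑ a ∈ range p, (a : ℚ) ^ m) = ∑ j ∈ range (m + 1 + N),
      (m.choose j : ℚ) * bernoulli (m - j) * (p : ℚ) ^ (j + 1) / (j + 1) := by
  rw [sum_range_pow, ← sum_range_reflect, sum_range_add _ (m + 1)]
  have h0 : ∑ x ∈ range N, (m.choose (m + 1 + x) : ℚ) * bernoulli (m - (m + 1 + x)) *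
      (p : ℚ) ^ (m + 1 + x + 1) / ((m + 1 + x : ℕ) + 1) = 0 :=
    sum_eq_zero fun x _ => by rw [Nat.choose_eq_zero_of_lt (by omega)]; simp
  push_cast at h0 ⊢
  rw [h0, add_zero]
  refine sum_congr rfl fun j hj => ?_
  rw [mem_range] at hj
  have h2 : m + 1 - (m - j) = j + 1 := by omega
  have h3 : (m + 1).choose (m - j) = (m + 1).choose (j + 1) := by
    rw [← h2, Nat.choose_symm (by omega)]
  have h4 := Nat.add_one_mul_choose_eq m j
  have h5 : ((m : ℚ) + 1) * m.choose j = (m + 1).choose (j + 1) * ((j : ℚ) + 1) := by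
    exact_mod_cast h4
  rw [h2, h3]
  field_simp
  linear_combination (-bernoulli (m - j) * (p : ℚ) ^ (j + 1)) * h5

variable (p : ℕ) [hpr : Fact p.Prime]

theorem exists_natCast_mul_eq_one {n : ℕ} (hn : ¬ p ∣ n) : ∃ z : ℤ_[p], (n : ℤ_[p]) * z = 1 := by
  have h : IsUnit (n : ℤ_[p]) := by
    rw [PadicInt.isUnit_iff]
    exact PadicInt.norm_natCast_eq_one_iff.2 ((hpr.out.coprime_iff_not_dvd).2 hn)
  exact h.exists_right_inv

/-- The bound on n forces its p-adic valuation to be at most e. This controls the denominators in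
the tails below. -/
theorem exists_pow_div {n e : ℕ} (h0 : n ≠ 0) (hn : n < p ^ (e + 1)) :
    ∃ z : ℤ_[p], (p : ℚ_[p]) ^ e / n = z := by
  obtain ⟨v, u, hu, rfl⟩ := Nat.exists_eq_pow_mul_and_not_dvd h0 p hpr.out.ne_one
  obtain ⟨w, hw⟩ := exists_natCast_mul_eq_one p hu
  have hu0 : 0 < u := Nat.pos_of_ne_zero (by rintro rfl; simp at hu)
  have hv : v ≤ e := by
    have h1 : p ^ v < p ^ (e + 1) := lt_of_le_of_lt (Nat.le_mul_of_pos_right _ hu0) hn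
    have := (Nat.pow_lt_pow_iff_right hpr.out.one_lt).1 h1
    omega
  obtain ⟨d, rfl⟩ := Nat.exists_eq_add_of_le hv
  refine ⟨p ^ d * w, ?_⟩
  have hp0 : (p : ℚ_[p]) ≠ 0 := by exact_mod_cast hpr.out.ne_zero
  have hw' : (u : ℚ_[p]) * w = 1 := by exact_mod_cast congrArg (fun z : ℤ_[p] => (z : ℚ_[p])) hw
  have hu1 : (u : ℚ_[p]) ≠ 0 := by exact_mod_cast hu0.ne'
  push_cast
  rw [div_eq_iff (by positivity)]
  rw [pow_add]
  linear_combination (-(p : ℚ_[p]) ^ v * p ^ d) * hw'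

attribute [local norm_cast] PadicInt.coe_sum

theorem exists_sum_eq_mul {ι : Type*} (s : Finset ι) (f : ι → ℚ_[p]) (c : ℚ_[p])
    (h : ∀ i ∈ s, ∃ z : ℤ_[p], f i = c * z) : ∃ z : ℤ_[p], ∑ i ∈ s, f i = c * z := by
  choose! z hz using h
  refine ⟨∑ i ∈ s, z i, ?_⟩
  rw [sum_congr rfl hz, ← mul_sum]
  push_cast
  ring

theorem sum_range_prime_eq {m : ℕ} (hm : m ≠ 0) :
    ∑ a ∈ range p, (a : ℚ) ^ m = ∑ a ∈ Icc 1 (p - 1), (a : ℚ) ^ m := by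
  have h : range p = insert 0 (Icc 1 (p - 1)) := by
    have := hpr.out.pos
    ext a
    simp only [mem_range, mem_insert, mem_Icc]
    omega
  rw [h, sum_insert (by simp)]
  simp [hm]

/-- Weak von Staudt–Clausen, by induction: p B_m is the leading Faulhaber term, and each other term
is an integer times p B_i with i < m times some p^(j+1)/(j+2). -/
theorem exists_p_mul_bernoulli (m : ℕ) :
    ∃ c : ℤ_[p], (p : ℚ_[p]) * ((bernoulli m : ℚ) : ℚ_[p]) = c := by
  induction m using Nat.strong_induction_on with
  | _ m ih =>
    have h := congrArg (fun x : ℚ => (x : ℚ_[p])) (sum_range_pow_eq p m 0)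
    rw [add_zero, sum_range_succ'] at h
    push_cast at h
    obtain ⟨z, hz⟩ := exists_sum_eq_mul p (range m) (fun j => (m.choose (j + 1) : ℚ_[p]) *
      ((bernoulli (m - (j + 1)) : ℚ) : ℚ_[p]) * (p : ℚ_[p]) ^ (j + 1 + 1) / (j + 1 + 1)) 1
      (fun j hj => by
        rw [mem_range] at hj
        obtain ⟨c, hc⟩ := ih (m - (j + 1)) (by omega)
        obtain ⟨d, hd⟩ := exists_pow_div p (n := j + 2) (e := j + 1) (by omega)
          (Nat.lt_pow_self hpr.out.one_lt)
        refine ⟨m.choose (j + 1) * c * d, ?_⟩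
        push_cast at hd ⊢
        rw [← hc, ← hd]
        ring)
    refine ⟨∑ a ∈ range p, (a : ℤ_[p]) ^ m - z, ?_⟩
    rw [hz] at h
    push_cast
    rw [h]
    simp
    ring

theorem sum_pow_modEq (hp : 7 ≤ p) {m : ℕ} (hm : m ≠ 0) :
    ∃ z : ℤ_[p], ((∑ a ∈ Icc 1 (p - 1), (a : ℚ) ^ m : ℚ) : ℚ_[p]) =
      p * ((bernoulli m : ℚ) : ℚ_[p]) + m / 2 * p ^ 2 * ((bernoulli (m - 1) : ℚ) : ℚ_[p])
      + m * (m - 1) / 6 * p ^ 3 * ((bernoulli (m - 2) : ℚ) : ℚ_[p])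
      + (m.choose 3) / 4 * p ^ 4 * ((bernoulli (m - 3) : ℚ) : ℚ_[p]) + p ^ 4 * z := by
  rw [← sum_range_prime_eq p hm, sum_range_pow_eq p m 3, show m + 1 + 3 = 4 + m by ring,
    sum_range_add]
  obtain ⟨z, hz⟩ := exists_sum_eq_mul p (range m) (fun j => (m.choose (4 + j) : ℚ_[p]) *
      ((bernoulli (m - (4 + j)) : ℚ) : ℚ_[p]) * (p : ℚ_[p]) ^ (4 + j + 1) / (4 + j + 1)) (p ^ 4)
      (fun j _ => by
        obtain ⟨c, hc⟩ := exists_p_mul_bernoulli p (m - (4 + j))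
        -- Four factors p go to the modulus and one to the Bernoulli number, leaving p^j/(j+5). At j
        -- = 0 this needs 5 prime to p, whence p ≥ 7.
        obtain ⟨d, hd⟩ := exists_pow_div p (n := 4 + j + 1) (e := j) (by omega) (by
          calc 4 + j + 1 < 7 ^ (j + 1) := by
                clear * -
                induction j with
                | zero => norm_num
                | succ j ih => rw [pow_succ]; omega
            _ ≤ p ^ (j + 1) := Nat.pow_le_pow_left hp _)
        refine ⟨m.choose (4 + j) * c * d, ?_⟩
        push_cast at hd ⊢
        rw [← hc, ← hd]
        ring)
  refine ⟨z, ?_⟩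
  push_cast
  rw [hz]
  simp only [sum_range_succ, sum_range_zero]
  rw [Nat.cast_choose_two]
  simp
  ring

/-- Comparison of the divided Bernoulli numbers with the moments, modulo `p ^ 2`. -/
theorem dB_modEq (hp : 7 ≤ p) {n : ℕ} (h : ¬ (p - 1) ∣ n + 1) :
    ∃ z : ℤ_[p], ((dB (n + 1) : ℚ) : ℚ_[p]) + p / 2 * ((bernoulli n : ℚ) : ℚ_[p])
      + n / 6 * p ^ 2 * ((bernoulli (n - 1) : ℚ) : ℚ_[p]) =
      U p 1 (n + 1) + n / 2 * p * U p 2 (n + 1) + p ^ 2 * z := by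
  have hp0 : (p : ℚ_[p]) ≠ 0 := by exact_mod_cast hpr.out.ne_zero
  have hn0 : ((n : ℚ_[p]) + 1) ≠ 0 := by exact_mod_cast Nat.succ_ne_zero n
  have hlt : ∀ j : ℕ, 4 + j < p ^ (j + 1) := fun j =>
    calc 4 + j < 7 ^ (j + 1) := by
          induction j with
          | zero => norm_num
          | succ j ih => rw [pow_succ]; omega
      _ ≤ p ^ (j + 1) := Nat.pow_le_pow_left hp _
  -- Pulls n+1 out of the binomial coefficients, so that dividing by (n+1)p costs no precision even
  -- when p divides n+1.
  have hch : ∀ j : ℕ, ((n + 1).choose (3 + j) : ℚ_[p]) * (3 + j) = (n + 1) * n.choose (2 + j) := by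
    intro j
    have h1 := Nat.add_one_mul_choose_eq n (2 + j)
    have h2 : ((n : ℚ_[p]) + 1) * n.choose (2 + j) = (n + 1).choose (2 + j + 1) * ((2 + j : ℕ) + 1) := by
      exact_mod_cast h1
    rw [h2, show 2 + j + 1 = 3 + j by ring]
    push_cast
    ring
  have h3 : ∀ j : ℕ, (3 + (j : ℚ_[p])) ≠ 0 := fun j => by
    exact_mod_cast (by omega : 3 + j ≠ 0)
  have h4 : ∀ j : ℕ, (4 + (j : ℚ_[p])) ≠ 0 := fun j => by
    exact_mod_cast (by omega : 4 + j ≠ 0)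
  have hB : ∃ z : ℤ_[p], ((∑ a ∈ Icc 1 (p - 1), (a : ℚ) ^ (n + 1) : ℚ) : ℚ_[p]) =
      (n + 1) * p * (((dB (n + 1) : ℚ) : ℚ_[p]) + p / 2 * ((bernoulli n : ℚ) : ℚ_[p])
      + n / 6 * p ^ 2 * ((bernoulli (n - 1) : ℚ) : ℚ_[p]) + p ^ 2 * z) := by
    rw [← sum_range_prime_eq p n.succ_ne_zero, sum_range_pow_eq p (n + 1) 2,
      show n + 1 + 1 + 2 = 3 + (n + 1) by ring, sum_range_add]
    obtain ⟨z, hz⟩ := exists_sum_eq_mul p (range (n + 1))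
      (fun j => ((n + 1).choose (3 + j) : ℚ_[p]) *
        ((bernoulli (n + 1 - (3 + j)) : ℚ) : ℚ_[p]) * (p : ℚ_[p]) ^ (3 + j + 1) / (3 + j + 1))
      ((n + 1) * p * p ^ 2)
      (fun j _ => by
        obtain ⟨c, hc⟩ := exists_p_mul_bernoulli p (n + 1 - (3 + j))
        obtain ⟨d, hd⟩ := exists_pow_div p (n := 4 + j) (e := j) (by omega) (hlt j)
        obtain ⟨e, he⟩ := exists_pow_div p (n := 3 + j) (e := j) (by omega)
          (lt_trans (by omega) (hlt j))
        -- Partial fractions: 1/((3+j)(4+j)) = 1/(3+j) - 1/(4+j).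
        refine ⟨n.choose (2 + j) * c * (e - d), ?_⟩
        push_cast at hd he ⊢
        rw [← hc, ← hd, ← he, show (3 : ℚ_[p]) + j + 1 = 4 + j by ring]
        have h1 := h3 j
        have h2 := h4 j
        field_simp
        rw [pow_add, pow_add]
        linear_combination (p ^ 4 * (p : ℚ_[p]) ^ j *
          ((bernoulli (n + 1 - (3 + j)) : ℚ) : ℚ_[p])) * hch j)
    refine ⟨z, ?_⟩
    push_cast
    rw [hz]
    simp only [sum_range_succ, sum_range_zero, dB]
    rw [Nat.cast_choose_two]
    simp
    field_simp
    ring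
  have hU : ∃ z : ℤ_[p], ((∑ a ∈ Icc 1 (p - 1), (a : ℚ) ^ (n + 1) : ℚ) : ℚ_[p]) =
      (n + 1) * p * (U p 1 (n + 1) + n / 2 * p * U p 2 (n + 1) + p ^ 2 * z) := by
    have h1 := congrArg (fun x : ℤ_[p] => (x : ℚ_[p])) (sum_pow_eq_U p (n + 1))
    have h2 : ∑ k ∈ range (n + 1 + 1), ((n + 1).choose k : ℤ_[p]) * p ^ k * U p k (n + 1)
        = ∑ k ∈ range (3 + n), ((n + 1).choose k : ℤ_[p]) * p ^ k * U p k (n + 1) := by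
      rw [show 3 + n = n + 1 + 1 + 1 by ring, sum_range_succ _ (n + 1 + 1)]
      simp
    rw [h2, sum_range_add] at h1
    push_cast at h1
    obtain ⟨z, hz⟩ := exists_sum_eq_mul p (range n)
      (fun j => ((n + 1).choose (3 + j) : ℚ_[p]) * p ^ (3 + j) * U p (3 + j) (n + 1))
      ((n + 1) * p * p ^ 2)
      (fun j _ => by
        obtain ⟨e, he⟩ := exists_pow_div p (n := 3 + j) (e := j) (by omega)
          (lt_trans (by omega) (hlt j))
        refine ⟨n.choose (2 + j) * U p (3 + j) (n + 1) * e, ?_⟩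
        push_cast at he ⊢
        rw [← he]
        have h1 := h3 j
        field_simp
        rw [pow_add]
        linear_combination (p ^ 3 * (p : ℚ_[p]) ^ j * U p (3 + j) (n + 1)) * hch j)
    refine ⟨z, ?_⟩
    push_cast
    rw [h1, hz]
    simp only [sum_range_succ, sum_range_zero, U_zero p h]
    rw [Nat.cast_choose_two]
    simp
    ring
  obtain ⟨z, hz⟩ := hB
  obtain ⟨w, hw⟩ := hU
  refine ⟨w - z, ?_⟩
  have h5 := mul_left_cancel₀ (mul_ne_zero hn0 hp0) (hz.symm.trans hw)
  push_cast
  linear_combination h5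

end Bernoulli

/-! ### Residues of p-integral rationals and Hensel digits -/

section Red

variable {p : ℕ} [hpr : Fact p.Prime]

variable (p) in
/-- The rational number `x` is a `p`-adic integer with residue `r` modulo `p`. -/
def Red (x : ℚ) (r : ZMod p) : Prop :=
  ∃ u : ℤ_[p], (u : ℚ_[p]) = (x : ℚ_[p]) ∧ PadicInt.toZMod u = r

theorem Red.add {x y : ℚ} {r s : ZMod p} : Red p x r → Red p y s → Red p (x + y) (r + s) := by
  rintro ⟨u, hu, rfl⟩ ⟨v, hv, rfl⟩
  exact ⟨u + v, by push_cast; rw [hu, hv], by simp⟩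

theorem Red.mul {x y : ℚ} {r s : ZMod p} : Red p x r → Red p y s → Red p (x * y) (r * s) := by
  rintro ⟨u, hu, rfl⟩ ⟨v, hv, rfl⟩
  exact ⟨u * v, by push_cast; rw [hu, hv], by simp⟩

theorem Red.neg {x : ℚ} {r : ZMod p} : Red p x r → Red p (-x) (-r) := by
  rintro ⟨u, hu, rfl⟩
  exact ⟨-u, by push_cast; rw [hu], by simp⟩

theorem Red.sub {x y : ℚ} {r s : ZMod p} (hx : Red p x r) (hy : Red p y s) :
    Red p (x - y) (r - s) := by
  rw [sub_eq_add_neg, sub_eq_add_neg]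
  exact hx.add hy.neg

theorem Red.natCast (n : ℕ) : Red p (n : ℚ) (n : ZMod p) := ⟨n, by simp, by simp⟩

theorem Red.zero : Red p 0 0 := by simpa using Red.natCast (p := p) 0

theorem Red.one : Red p 1 1 := by simpa using Red.natCast (p := p) 1

theorem Red.ofNat (n : ℕ) [n.AtLeastTwo] : Red p (OfNat.ofNat n) (OfNat.ofNat n) := by
  have h := Red.natCast (p := p) (OfNat.ofNat n)
  rwa [Nat.cast_ofNat, Nat.cast_ofNat] at h

theorem Red.pow {x : ℚ} {r : ZMod p} (h : Red p x r) (k : ℕ) : Red p (x ^ k) (r ^ k) := by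
  obtain ⟨u, hu, rfl⟩ := h
  exact ⟨u ^ k, by push_cast; rw [hu], by simp⟩

theorem Red.sum {ι : Type*} {s : Finset ι} {f : ι → ℚ} {g : ι → ZMod p}
    (h : ∀ i ∈ s, Red p (f i) (g i)) : Red p (∑ i ∈ s, f i) (∑ i ∈ s, g i) := by
  classical
  induction s using Finset.induction_on with
  | empty => simpa using Red.zero
  | insert a s ha ih =>
    rw [sum_insert ha, sum_insert ha]
    exact (h a (mem_insert_self a s)).add (ih fun i hi => h i (mem_insert_of_mem hi))

theorem Red.inv {x : ℚ} {r : ZMod p} (h : Red p x r) (hr : r ≠ 0) : Red p x⁻¹ r⁻¹ := by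
  obtain ⟨u, hu, rfl⟩ := h
  have h1 : IsUnit u := by
    by_contra hcon
    apply hr
    rw [← RingHom.mem_ker, PadicInt.ker_toZMod]
    exact (IsLocalRing.mem_maximalIdeal u).2 hcon
  obtain ⟨w, hw⟩ := h1.exists_right_inv
  refine ⟨w, ?_, ?_⟩
  · have h2 : (u : ℚ_[p]) * w = 1 := by exact_mod_cast congrArg (fun z : ℤ_[p] => (z : ℚ_[p])) hw
    rw [Rat.cast_inv, ← hu]
    exact eq_inv_of_mul_eq_one_right h2
  · have h2 := congrArg PadicInt.toZMod hw
    rw [map_mul, map_one] at h2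
    exact eq_inv_of_mul_eq_one_right h2

theorem Red.div {x y : ℚ} {r s : ZMod p} (hx : Red p x r) (hy : Red p y s) (hs : s ≠ 0) :
    Red p (x / y) (r / s) := by
  rw [div_eq_mul_inv, div_eq_mul_inv]
  exact hx.mul (hy.inv hs)

theorem Red.isPInt {x : ℚ} {r : ZMod p} (h : Red p x r) : IsPInt p x := by
  obtain ⟨u, hu, -⟩ := h
  rw [IsPInt, ← hu]
  exact u.2

theorem Red.congrModP {x y : ℚ} {r s : ZMod p} (hx : Red p x r) (hy : Red p y s) (h : r = s) :
    CongrModP p x y := by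
  obtain ⟨u, hu, rfl⟩ := hx
  obtain ⟨v, hv, rfl⟩ := hy
  refine ⟨u, v, hu, hv, ?_⟩
  obtain ⟨c, hc⟩ := (toZMod_eq_zero_iff p (u - v)).1 (by rw [map_sub, h, sub_self])
  exact ⟨c, hc⟩

/-- If `x / p ^ i` is a `p`-adic integer, its residue is the Hensel digit `(x)_i`. -/
theorem Red.hres {x : ℚ} {i : ℕ} {r : ZMod p} (h : Red p (x / (p : ℚ) ^ i) r) :
    IsPInt p x ∧ Red p (hres p x i) r := by
  obtain ⟨u, hu, rfl⟩ := h
  have hp0 : (p : ℚ_[p]) ≠ 0 := by exact_mod_cast hpr.out.ne_zero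
  have hx : (x : ℚ_[p]) = ((p ^ i * u : ℤ_[p]) : ℚ_[p]) := by
    push_cast
    rw [hu]
    push_cast
    field_simp
  have hint : IsPInt p x := by
    rw [IsPInt, hx]
    exact PadicInt.norm_le_one _
  refine ⟨hint, ?_⟩
  have hX : (⟨(x : ℚ_[p]), hint⟩ : ℤ_[p]) = (p : ℤ_[p]) ^ i * u := PadicInt.ext hx
  rw [_root_.hres, dif_pos hint, hX, henselDigit]
  have hs := PadicInt.appr_spec (i + 1) ((p : ℤ_[p]) ^ i * u)
  obtain ⟨c, hc⟩ := Ideal.mem_span_singleton.1 hs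
  set A := ((p : ℤ_[p]) ^ i * u).appr (i + 1) with hA
  -- A ≡ p^i u modulo p^(i+1), so A is divisible by p^i and the quotient, which is the digit, is u
  -- modulo p.
  have hdvd : p ^ i ∣ A := by
    have h1 : (p : ℤ_[p]) ^ i ∣ ((A : ℤ) : ℤ_[p]) := ⟨u - p * c, by
      push_cast
      linear_combination -hc⟩
    have h2 := (PadicInt.pow_p_dvd_int_iff i (A : ℤ)).1 h1
    exact_mod_cast h2
  obtain ⟨d, hd⟩ := hdvd
  rw [hd, Nat.mul_div_cancel_left _ (pow_pos hpr.out.pos i)]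
  have hpi : (p : ℤ_[p]) ^ i ≠ 0 := pow_ne_zero _ (by exact_mod_cast hpr.out.ne_zero)
  have hdu : (d : ℤ_[p]) = u - p * c := by
    apply mul_left_cancel₀ hpi
    have h3 : (A : ℤ_[p]) = p ^ i * d := by rw [hd]; push_cast; ring
    rw [← h3]
    linear_combination -hc
  have h4 := congrArg PadicInt.toZMod hdu
  rw [map_natCast, map_sub, map_mul, map_natCast, CharP.cast_eq_zero (ZMod p) p, zero_mul,
    sub_zero] at h4
  rw [← h4]
  exact Red.natCast d

theorem toZMod_eq_of_mul_eq {a b z : ℤ_[p]} (h : (p : ℚ_[p]) * a = p * b + p ^ 2 * z) :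
    PadicInt.toZMod a = PadicInt.toZMod b := by
  have hp0 : (p : ℤ_[p]) ≠ 0 := by exact_mod_cast hpr.out.ne_zero
  have h1 : (p : ℤ_[p]) * a = p * b + p ^ 2 * z := by
    apply PadicInt.ext
    push_cast
    exact h
  have h2 : a = b + p * z := mul_left_cancel₀ hp0 (by rw [h1]; ring)
  rw [h2]
  simp

theorem natCast_zmod_ne_zero {n : ℕ} (h0 : n ≠ 0) (hn : n < p) : (n : ZMod p) ≠ 0 := by
  rw [Ne, ZMod.natCast_eq_zero_iff]
  exact Nat.not_dvd_of_pos_of_lt (Nat.pos_of_ne_zero h0) hn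

theorem two_ne_zero_zmod (hp : 7 ≤ p) : (2 : ZMod p) ≠ 0 := by
  exact_mod_cast natCast_zmod_ne_zero (p := p) (n := 2) (by norm_num) (by omega)

theorem six_ne_zero_zmod (hp : 7 ≤ p) : (6 : ZMod p) ≠ 0 := by
  exact_mod_cast natCast_zmod_ne_zero (p := p) (n := 6) (by norm_num) (by omega)

theorem four_ne_zero_zmod (hp : 7 ≤ p) : (4 : ZMod p) ≠ 0 := by
  exact_mod_cast natCast_zmod_ne_zero (p := p) (n := 4) (by norm_num) (by omega)

theorem exists_padic_half (hp : 7 ≤ p) :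
    ∃ w : ℤ_[p], (w : ℚ_[p]) = 1 / 2 ∧ PadicInt.toZMod w = 1 / 2 := by
  obtain ⟨w, hw, h⟩ := Red.one.div (Red.ofNat (p := p) 2) (two_ne_zero_zmod hp)
  exact ⟨w, by rw [hw]; push_cast; rfl, h⟩

theorem exists_padic_sixth (hp : 7 ≤ p) :
    ∃ w : ℤ_[p], (w : ℚ_[p]) = 1 / 6 ∧ PadicInt.toZMod w = 1 / 6 := by
  obtain ⟨w, hw, h⟩ := Red.one.div (Red.ofNat (p := p) 6) (six_ne_zero_zmod hp)
  exact ⟨w, by rw [hw]; push_cast; rfl, h⟩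

theorem exists_padic_fourth (hp : 7 ≤ p) :
    ∃ w : ℤ_[p], (w : ℚ_[p]) = 1 / 4 ∧ PadicInt.toZMod w = 1 / 4 := by
  obtain ⟨w, hw, h⟩ := Red.one.div (Red.ofNat (p := p) 4) (four_ne_zero_zmod hp)
  exact ⟨w, by rw [hw]; push_cast; rfl, h⟩

end Red

/-! ### Fermat and Wilson quotients as moments -/

section Quotients

variable {p : ℕ} [hpr : Fact p.Prime]

theorem red_val (x : (ZMod p)ˣ) : Red p ((x : ZMod p).val : ℚ) (x : ZMod p) := by
  simpa using Red.natCast (p := p) (x : ZMod p).val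

/-- (1 + p t)^(p-1) ≡ 1 + (p-1) p t mod p^2, and p-1 ≡ -1. -/
theorem red_fermatQ (x : (ZMod p)ˣ) : Red p (fermatQ p (x : ZMod p).val) (-tau p x) := by
  obtain ⟨z, hz⟩ := exists_prod_one_add (p : ℤ_[p]) (range (p - 1)) (fun _ => tq p x)
  have hp0 : (p : ℚ_[p]) ≠ 0 := by exact_mod_cast hpr.out.ne_zero
  have h1 : (((x : ZMod p).val : ℕ) : ℤ_[p]) ^ (p - 1) =
      1 + p * ((p - 1) * tq p x) + p ^ 2 * z := by
    rw [val_eq_teich_mul, mul_pow, teich_pow_sub_one, one_mul]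
    simpa [Nat.cast_sub hpr.out.one_le] using hz
  refine ⟨(p - 1) * tq p x + p * z, ?_, ?_⟩
  · have h2 := congrArg (fun y : ℤ_[p] => (y : ℚ_[p])) h1
    push_cast at h2
    rw [fermatQ]
    push_cast
    rw [h2]
    field_simp
    ring
  · simp [tau]

theorem red_wilsonQ (hp : 7 ≤ p) : Red p (wilsonQ p) (-V p 1 0) := by
  obtain ⟨z, hz⟩ := factorial_eq_U p (by omega)
  have hp0 : (p : ℚ_[p]) ≠ 0 := by exact_mod_cast hpr.out.ne_zero
  refine ⟨-U p 1 0 + p * z, ?_, by simp [V]⟩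
  have h2 := congrArg (fun y : ℤ_[p] => (y : ℚ_[p])) hz
  push_cast at h2
  rw [wilsonQ]
  push_cast
  rw [h2]
  field_simp

theorem red_sum_fermatQ_cube {s : ℕ} (hs : s ≤ p - 1) :
    Red p (∑ a ∈ Icc 1 (p - 1), fermatQ p a ^ 3 / (a : ℚ) ^ s) (-V p 3 (p - 1 - s)) := by
  rw [sum_Icc_eq_sum_units p (fun a => fermatQ p a ^ 3 / (a : ℚ) ^ s), V_eq, ← sum_neg_distrib]
  refine Red.sum fun x _ => ?_
  have h := ((red_fermatQ x).pow 3).div ((red_val x).pow s) (pow_ne_zero _ x.ne_zero)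
  convert h using 1
  rw [eq_div_iff (pow_ne_zero _ x.ne_zero)]
  have h1 : (x : ZMod p) ^ (p - 1 - s) * (x : ZMod p) ^ s = 1 := by
    rw [← pow_add, Nat.sub_add_cancel hs]
    exact ZMod.pow_card_sub_one_eq_one x.ne_zero
  linear_combination (-tau p x ^ 3) * h1

/-- The combination is ∑ a^m (a^(p-1) - 1)^3, and each cube is p^3 q_a^3. -/
theorem red_third_difference (m : ℕ) :
    Red p ((∑ a ∈ Icc 1 (p - 1), (a : ℚ) ^ (m + 3 * (p - 1))
      - 3 * ∑ a ∈ Icc 1 (p - 1), (a : ℚ) ^ (m + 2 * (p - 1))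
      + 3 * ∑ a ∈ Icc 1 (p - 1), (a : ℚ) ^ (m + (p - 1))
      - ∑ a ∈ Icc 1 (p - 1), (a : ℚ) ^ m) / (p : ℚ) ^ 3) (-V p 3 m) := by
  have hp0 : (p : ℚ) ≠ 0 := by exact_mod_cast hpr.out.ne_zero
  have h : (∑ a ∈ Icc 1 (p - 1), (a : ℚ) ^ (m + 3 * (p - 1))
      - 3 * ∑ a ∈ Icc 1 (p - 1), (a : ℚ) ^ (m + 2 * (p - 1))
      + 3 * ∑ a ∈ Icc 1 (p - 1), (a : ℚ) ^ (m + (p - 1))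
      - ∑ a ∈ Icc 1 (p - 1), (a : ℚ) ^ m) / (p : ℚ) ^ 3 =
      ∑ a ∈ Icc 1 (p - 1), (a : ℚ) ^ m * fermatQ p a ^ 3 := by
    rw [mul_sum, mul_sum, ← sum_sub_distrib, ← sum_add_distrib, ← sum_sub_distrib, sum_div]
    refine sum_congr rfl fun a _ => ?_
    rw [fermatQ]
    field_simp
    ring
  rw [h, sum_Icc_eq_sum_units p (fun a => (a : ℚ) ^ m * fermatQ p a ^ 3), V_eq,
    ← sum_neg_distrib]
  refine Red.sum fun x _ => ?_
  have h := ((red_val x).pow m).mul ((red_fermatQ x).pow 3)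
  convert h using 1
  ring

end Quotients

/-! ### Divided Bernoulli numbers and their Kummer differences -/

section DividedBernoulli

theorem not_dvd_of_lt {p m : ℕ} (h0 : 0 < m) (h : m < p - 1) : ¬ (p - 1) ∣ m := fun hd =>
  absurd (Nat.le_of_dvd h0 hd) (by omega)

theorem not_dvd_add {p m : ℕ} (h : ¬ (p - 1) ∣ m) : ¬ (p - 1) ∣ m + (p - 1) := by
  rwa [Nat.dvd_add_self_right]

variable {p : ℕ} [hpr : Fact p.Prime]

theorem dB_odd {m : ℕ} (hm : Odd m) (h1 : 1 < m) : dB m = 0 := by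
  rw [dB, bernoulli_eq_zero_of_odd hm h1, zero_div]

theorem bernoulli_eq_mul_dB {m : ℕ} (hm : m ≠ 0) : bernoulli m = m * dB m := by
  rw [dB]
  field_simp

/-- Kummer's congruence, with the common residue identified as a moment. -/
theorem red_dB (hp : 7 ≤ p) {m : ℕ} (h2 : 2 ≤ m) (he : Even m) (hd : ¬ (p - 1) ∣ m) :
    Red p (dB m) (V p 1 m) := by
  obtain ⟨n, rfl⟩ : ∃ n, m = n + 1 := ⟨m - 1, by omega⟩
  obtain ⟨z, hz⟩ := dB_modEq p hp hd
  obtain ⟨w2, hw2, -⟩ := exists_padic_half hp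
  obtain ⟨w4, hw4, -⟩ := exists_padic_fourth hp
  obtain ⟨w6, hw6, -⟩ := exists_padic_sixth hp
  obtain ⟨c, hc⟩ := exists_p_mul_bernoulli p (n - 1)
  rcases Nat.lt_or_ge 1 n with h | h
  · have ho : Odd n := by
      rcases Nat.even_or_odd n with h' | h'
      · exact absurd he (by simpa using h'.add_one)
      · exact h'
    rw [bernoulli_eq_zero_of_odd ho h, ← mul_one_div, ← hw2] at hz
    refine ⟨U p 1 (n + 1) + p * (n * w2 * U p 2 (n + 1) + p * z - n * w6 * c), ?_, by simp [V]⟩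
    push_cast
    rw [← hc, hw6]
    rw [hw2] at hz ⊢
    push_cast at hz
    linear_combination -hz
  -- Only for m = 2 is B_{m-1} nonzero among the even m; its contribution p/4 still vanishes modulo
  -- p.
  · obtain rfl : n = 1 := by omega
    rw [bernoulli_one] at hz
    refine ⟨U p 1 (1 + 1) + p * (w2 * U p 2 (1 + 1) + p * z - w6 * c + w4), ?_, by simp [V]⟩
    push_cast
    rw [← hc, hw6, hw2, hw4]
    push_cast at hz
    linear_combination -hz

theorem V_one_one (hp : 7 ≤ p) : V p 1 1 = -(1 / 2) := by
  obtain ⟨z, hz⟩ := dB_modEq p hp (n := 0) (fun h => by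
    have := Nat.le_of_dvd (by norm_num) h
    omega)
  obtain ⟨w2, hw2, hw2'⟩ := exists_padic_half hp
  have h : (p : ℚ_[p]) * ((-w2 : ℤ_[p]) : ℚ_[p]) =
      p * U p 1 1 + p ^ 2 * ((p * z - w2 : ℤ_[p]) : ℚ_[p]) := by
    push_cast
    rw [hw2]
    simp [dB] at hz
    linear_combination (p : ℚ_[p]) * hz
  rw [← hw2', V, ← map_neg]
  exact (toZMod_eq_of_mul_eq h).symm

theorem even_prime_sub_one (hp : 7 ≤ p) : Even (p - 1) :=
  hpr.out.even_sub_one (by omega)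

theorem V_one_odd (hp : 7 ≤ p) {m : ℕ} (h3 : 3 ≤ m) (hm : m ≤ p - 2) (ho : Odd m) :
    V p 1 m = 0 := by
  obtain ⟨n, rfl⟩ : ∃ n, m = n + 1 := ⟨m - 1, by omega⟩
  have hn : Even n := by
    rcases Nat.even_or_odd n with h | h
    · exact h
    · exact absurd ho (by simpa using h.add_one)
  obtain ⟨z, hz⟩ := dB_modEq p hp (not_dvd_of_lt (m := n + 1) (by omega) (by omega))
  obtain ⟨w2, hw2, -⟩ := exists_padic_half hp
  obtain ⟨w6, hw6, -⟩ := exists_padic_sixth hp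
  obtain ⟨b, hb, -⟩ := (Red.natCast (p := p) n).mul
    (red_dB hp (by omega) hn (not_dvd_of_lt (by omega) (by omega)))
  rw [← bernoulli_eq_mul_dB (by omega)] at hb
  obtain ⟨c, hc⟩ := exists_p_mul_bernoulli p (n - 1)
  rw [dB_odd ho (by omega), ← hb] at hz
  have h : U p 1 (n + 1) = p * (w2 * b + n * w6 * c - n * w2 * U p 2 (n + 1) - p * z) := by
    apply PadicInt.ext
    push_cast
    rw [hw2, hw6, ← hc]
    push_cast at hz
    linear_combination -hz
  rw [V, h]
  simp

/-- Compare `dB_modEq` at m and m+p-1. The odd divided Bernoulli numbers vanish and the V_1 terms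
agree, so the order-p part gives V_2(m) ≡ B_{m-1} - B_{m+p-2}. By Kummer this is ((m-1) - (m-2))
V_1(m-1). -/
theorem V_two_odd (hp : 7 ≤ p) {m : ℕ} (h3 : 3 ≤ m) (hm : m ≤ p - 2) (ho : Odd m) :
    V p 2 m = V p 1 (m - 1) := by
  obtain ⟨n, rfl⟩ : ∃ n, m = n + 1 := ⟨m - 1, by omega⟩
  have hn : Even n := by
    rcases Nat.even_or_odd n with h | h
    · exact h
    · exact absurd ho (by simpa using h.add_one)
  have hev := even_prime_sub_one hp
  have hd1 : ¬ (p - 1) ∣ n + 1 := not_dvd_of_lt (by omega) (by omega)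
  have hd0 : ¬ (p - 1) ∣ n := not_dvd_of_lt (by omega) (by omega)
  obtain ⟨z, hz⟩ := dB_modEq p hp hd1
  obtain ⟨y, hy⟩ := dB_modEq p hp (n := n + (p - 1)) (by
    rw [Nat.add_right_comm]; exact not_dvd_add hd1)
  obtain ⟨w2, hw2, hw2'⟩ := exists_padic_half hp
  obtain ⟨w6, hw6, -⟩ := exists_padic_sixth hp
  obtain ⟨b, hb, hb'⟩ := (Red.natCast (p := p) n).mul (red_dB hp (by omega) hn hd0)
  rw [← bernoulli_eq_mul_dB (by omega)] at hb
  obtain ⟨c, hc, hc'⟩ := (Red.natCast (p := p) (n + (p - 1))).mul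
    (red_dB hp (by omega) (hn.add hev) (not_dvd_add hd0))
  rw [← bernoulli_eq_mul_dB (by omega)] at hc
  obtain ⟨e, he⟩ : ∃ e : ℤ_[p], (e : ℚ_[p]) = ((bernoulli (n - 1) : ℚ) : ℚ_[p]) := by
    rcases Nat.lt_or_ge 2 n with h | h
    · exact ⟨0, by rw [bernoulli_eq_zero_of_odd (Nat.Even.sub_odd (by omega) hn odd_one)
        (by omega)]; simp⟩
    · obtain rfl : n = 2 := by omega
      refine ⟨-w2, ?_⟩
      rw [show 2 - 1 = 1 from rfl, bernoulli_one]
      push_cast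
      rw [hw2]
      ring
  have hf : bernoulli (n + (p - 1) - 1) = 0 :=
    bernoulli_eq_zero_of_odd (Nat.Even.sub_odd (by omega) (hn.add hev) odd_one) (by omega)
  rw [dB_odd ho (by omega), ← hb, ← he] at hz
  rw [dB_odd (by rw [Nat.add_right_comm]; exact ho.add_even hev) (by omega), ← hc, hf,
    Nat.add_right_comm, U_add, U_add] at hy
  have hpc : ((n + (p - 1) : ℕ) : ℚ_[p]) = n + p - 1 := by
    rw [Nat.cast_add, Nat.cast_sub hpr.out.one_le]; push_cast; ring
  have h : (p : ℚ_[p]) * ((w2 * (c - b) : ℤ_[p]) : ℚ_[p]) =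
      p * ((-w2 * U p 2 (n + 1) : ℤ_[p]) : ℚ_[p]) +
        p ^ 2 * ((w2 * U p 2 (n + 1) + y - z + n * w6 * e : ℤ_[p]) : ℚ_[p]) := by
    push_cast
    rw [hw2, hw6]
    rw [hpc] at hy
    push_cast at hy hz
    linear_combination hy - hz
  have h1 := toZMod_eq_of_mul_eq h
  rw [map_mul, map_sub, map_mul, map_neg, hw2', hb', hc', V_add p 1 rfl, Nat.cast_add,
    Nat.cast_sub hpr.out.one_le] at h1
  have h2 := two_ne_zero_zmod hp
  simp only [CharP.cast_eq_zero, Nat.add_sub_cancel] at h1 ⊢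
  rw [V]
  field_simp at h1
  push_cast at h1
  linear_combination h1

/-- Subtracting `dB_modEq` at m and m+p-1 cancels V_1 and changes the coefficient of p V_2 by
(p-1)/2. The condition on m-2 makes B_{m-2} and B_{m+p-3} p-integral, so their terms are negligible.
-/
theorem red_dB_sub (hp : 7 ≤ p) {m : ℕ} (h4 : 4 ≤ m) (he : Even m) (hd : ¬ (p - 1) ∣ m)
    (hd2 : ¬ (p - 1) ∣ m - 2) :
    Red p ((dB (m + (p - 1)) - dB m) / (p : ℚ) ^ 1) (-(1 / 2) * V p 2 m) := by
  obtain ⟨n, rfl⟩ : ∃ n, m = n + 1 := ⟨m - 1, by omega⟩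
  have hn : Odd n := by
    rcases Nat.even_or_odd n with h' | h'
    · exact absurd he (by simpa using h'.add_one)
    · exact h'
  have hev := even_prime_sub_one hp
  have hp0 : (p : ℚ_[p]) ≠ 0 := by exact_mod_cast hpr.out.ne_zero
  rw [show n + 1 - 2 = n - 1 by omega] at hd2
  have hn1 : Even (n - 1) := Nat.Odd.sub_odd hn odd_one
  obtain ⟨z, hz⟩ := dB_modEq p hp hd
  obtain ⟨y, hy⟩ := dB_modEq p hp (n := n + (p - 1)) (by
    rw [Nat.add_right_comm]; exact not_dvd_add hd)
  obtain ⟨w2, hw2, hw2'⟩ := exists_padic_half hp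
  obtain ⟨w6, hw6, -⟩ := exists_padic_sixth hp
  obtain ⟨b, hb, -⟩ := (Red.natCast (p := p) (n - 1)).mul (red_dB hp (by omega) hn1 hd2)
  rw [← bernoulli_eq_mul_dB (by omega)] at hb
  obtain ⟨c, hc, -⟩ := (Red.natCast (p := p) (n - 1 + (p - 1))).mul
    (red_dB hp (by omega) (hn1.add hev) (not_dvd_add hd2))
  rw [← bernoulli_eq_mul_dB (by omega), show n - 1 + (p - 1) = n + (p - 1) - 1 by omega] at hc
  rw [bernoulli_eq_zero_of_odd hn (by omega), ← hb] at hz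
  rw [bernoulli_eq_zero_of_odd (hn.add_even hev) (by omega), ← hc, Nat.add_right_comm,
    U_add, U_add] at hy
  have hpc : ((n + (p - 1) : ℕ) : ℚ_[p]) = n + p - 1 := by
    rw [Nat.cast_add, Nat.cast_sub hpr.out.one_le]; push_cast; ring
  refine ⟨(p - 1) * w2 * U p 2 (n + 1) + p * (y - z - (n + p - 1) * w6 * c + n * w6 * b), ?_, ?_⟩
  · push_cast
    rw [hw2, hw6, eq_div_iff (by simpa using hp0)]
    rw [hpc] at hy
    push_cast at hy hz
    linear_combination hz - hy
  · simp [V, hw2']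

/-- Here B_1 = -1/2 enters at index 2 while B_p = 0 enters at p+1; this asymmetry produces -1/4. -/
theorem red_dB_sub_two (hp : 7 ≤ p) :
    Red p ((dB (p + 1) - dB 2) / (p : ℚ) ^ 1) (-(1 / 2) * V p 2 2 - 1 / 4) := by
  have hp0 : (p : ℚ_[p]) ≠ 0 := by exact_mod_cast hpr.out.ne_zero
  have hd : ¬ (p - 1) ∣ 2 := not_dvd_of_lt (by omega) (by omega)
  have hdp : 2 + (p - 1) = p + 1 := by omega
  obtain ⟨z, hz⟩ := dB_modEq p hp (n := 1) hd
  obtain ⟨y, hy⟩ := dB_modEq p hp (n := p) (by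
    rw [← hdp]; exact not_dvd_add hd)
  obtain ⟨w2, hw2, hw2'⟩ := exists_padic_half hp
  obtain ⟨w4, hw4, hw4'⟩ := exists_padic_fourth hp
  obtain ⟨w6, hw6, -⟩ := exists_padic_sixth hp
  obtain ⟨c, hc⟩ := exists_p_mul_bernoulli p (p - 1)
  rw [bernoulli_one, Nat.sub_self, bernoulli_zero] at hz
  rw [bernoulli_eq_zero_of_odd (hpr.out.odd_of_ne_two (by omega)) (by omega), ← hdp,
    U_add, U_add, hdp] at hy
  refine ⟨-w2 * U p 2 2 - w4 + p * (w2 * U p 2 2 + y - z + w6 - w6 * c), ?_, ?_⟩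
  · push_cast
    rw [hw2, hw4, hw6, eq_div_iff (by simpa using hp0), ← hc]
    push_cast at hy hz
    linear_combination hz - hy
  · simp [V, hw2', hw4']

end DividedBernoulli

/-! ### Power sums to higher p-adic precision -/

section PowerSums

variable {p : ℕ} [hpr : Fact p.Prime]

attribute [local norm_cast] PadicInt.coe_sum

/-- Power sums of exponent divisible by `p - 1`, modulo `p ^ 3`. -/
theorem sum_pow_mul_modEq (j : ℕ) :
    ∃ z : ℤ_[p], ((∑ a ∈ Icc 1 (p - 1), (a : ℚ) ^ (j * (p - 1)) : ℚ) : ℚ_[p]) =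
      (p - 1) * (1 + j * p * U p 1 0 + j * (j * (p - 1) - 1) / 2 * p ^ 2 * U p 2 0)
        + p ^ 3 * z := by
  have h1 := congrArg (fun x : ℤ_[p] => (x : ℚ_[p])) (sum_pow_eq_U p (j * (p - 1)))
  set m := j * (p - 1) with hm
  have hmc : (m : ℚ_[p]) = j * (p - 1) := by
    rw [hm, Nat.cast_mul, Nat.cast_sub hpr.out.one_le, Nat.cast_one]
  have h2 : ∑ k ∈ range (m + 1), (m.choose k : ℤ_[p]) * p ^ k * U p k m
      = ∑ k ∈ range (3 + m), (m.choose k : ℤ_[p]) * p ^ k * U p k m := by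
    rw [show 3 + m = m + 1 + 1 + 1 by ring, sum_range_succ _ (m + 1 + 1),
      sum_range_succ _ (m + 1)]
    simp [Nat.choose_eq_zero_of_lt]
  rw [h2, sum_range_add] at h1
  push_cast at h1
  obtain ⟨z, hz⟩ := exists_sum_eq_mul p (range m)
    (fun i => (m.choose (3 + i) : ℚ_[p]) * p ^ (3 + i) * U p (3 + i) m) (p ^ 3)
    (fun i _ => ⟨m.choose (3 + i) * p ^ i * U p (3 + i) m, by push_cast; ring⟩)
  refine ⟨z, ?_⟩
  push_cast
  rw [h1, hz]
  simp only [sum_range_succ, sum_range_zero]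
  rw [Nat.cast_choose_two, hm, U_mul, U_mul, U_mul, ← hm, hmc, U_zero_zero]
  simp [hmc]
  ring

/-- Power sums of even exponent, modulo `p ^ 4`. -/
theorem sum_pow_even_modEq (hp : 7 ≤ p) {m : ℕ} (h4 : 4 ≤ m) (he : Even m)
    (hd : ¬ (p - 1) ∣ m - 2) :
    Red p ((∑ a ∈ Icc 1 (p - 1), (a : ℚ) ^ m - p * bernoulli m) / (p : ℚ) ^ 3)
      ((m : ZMod p) * (m - 1) * (m - 2) / 6 * V p 1 (m - 2)) := by
  have hp0 : (p : ℚ_[p]) ≠ 0 := by exact_mod_cast hpr.out.ne_zero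
  obtain ⟨z, hz⟩ := sum_pow_modEq p hp (m := m) (by omega)
  obtain ⟨b, hb, hb'⟩ := (Red.natCast (p := p) (m - 2)).mul
    (red_dB hp (by omega) (by rw [Nat.even_sub (by omega)]; simp [he]) hd)
  rw [← bernoulli_eq_mul_dB (by omega)] at hb
  obtain ⟨w4, hw4, -⟩ := exists_padic_fourth hp
  obtain ⟨w6, hw6, hw6'⟩ := exists_padic_sixth hp
  obtain ⟨w2, hw2, -⟩ := exists_padic_half hp
  have hodd1 : Odd (m - 1) := Nat.Even.sub_odd (by omega) he odd_one
  have hodd3 : Odd (m - 3) := Nat.Even.sub_odd (by omega) he (by decide)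
  obtain ⟨e, hb3⟩ : ∃ e : ℤ_[p], (e : ℚ_[p]) = ((bernoulli (m - 3) : ℚ) : ℚ_[p]) := by
    rcases Nat.lt_or_ge 4 m with h | h
    · exact ⟨0, by rw [bernoulli_eq_zero_of_odd hodd3 (by obtain ⟨k, hk⟩ := he; omega)]; simp⟩
    · obtain rfl : m = 4 := by omega
      refine ⟨-w2, ?_⟩
      rw [show 4 - 3 = 1 from rfl, bernoulli_one]
      push_cast
      rw [hw2]
      ring
  rw [bernoulli_eq_zero_of_odd hodd1 (by omega), ← hb, ← hb3] at hz
  refine ⟨m * (m - 1) * w6 * b + p * (m.choose 3 * w4 * e + z), ?_, ?_⟩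
  · rw [Rat.cast_div, Rat.cast_sub, hz]
    push_cast
    rw [hw4, hw6]
    field_simp
    ring
  · rw [map_add, map_mul, map_mul, map_mul, map_sub, map_natCast, hb', hw6', map_mul,
      map_natCast, CharP.cast_eq_zero (ZMod p) p, Nat.cast_sub (by omega)]
    simp
    ring

theorem sum_pow_mul_modEq_bernoulli (hp : 7 ≤ p) {j : ℕ} (hj : j ≠ 0) :
    ∃ z : ℤ_[p], (p : ℚ_[p]) * ((bernoulli (j * (p - 1)) : ℚ) : ℚ_[p]) =
      (p - 1) * (1 + j * p * U p 1 0 + j * (j * (p - 1) - 1) / 2 * p ^ 2 * U p 2 0)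
        + p ^ 3 * z := by
  have hp0 : (p : ℚ_[p]) ≠ 0 := by exact_mod_cast hpr.out.ne_zero
  have hle : p - 1 ≤ j * (p - 1) := Nat.le_mul_of_pos_left _ (Nat.pos_of_ne_zero hj)
  obtain ⟨u, hu, -⟩ := sum_pow_even_modEq hp (m := j * (p - 1)) (by omega)
    ((even_prime_sub_one hp).mul_left j) (fun h => by
      have h1 := Nat.dvd_sub (dvd_mul_left (p - 1) j) h
      rw [Nat.sub_sub_self (by omega)] at h1
      have := Nat.le_of_dvd (by norm_num) h1
      omega)
  obtain ⟨z, hz⟩ := sum_pow_mul_modEq (p := p) j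
  refine ⟨z - u, ?_⟩
  rw [Rat.cast_div, Rat.cast_sub, hz, Rat.cast_mul, eq_div_iff (by simpa using hp0)] at hu
  push_cast at hu ⊢
  linear_combination hu

theorem red_agohGiugaQ (hp : 7 ≤ p) : Red p (agohGiugaQ p - 1) (-V p 1 0) := by
  have hp0 : (p : ℚ_[p]) ≠ 0 := by exact_mod_cast hpr.out.ne_zero
  obtain ⟨z, hz⟩ := sum_pow_mul_modEq_bernoulli hp (j := 1) one_ne_zero
  obtain ⟨w2, hw2, -⟩ := exists_padic_half hp
  rw [one_mul] at hz
  refine ⟨(p - 1) * U p 1 0 + p * ((p - 1) * (p - 1 - 1) * w2 * U p 2 0 + p * z), ?_, by simp [V]⟩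
  rw [agohGiugaQ]
  push_cast
  rw [hz, hw2]
  field_simp
  push_cast
  ring

theorem red_convolution_term (hp : 7 ≤ p) :
    Red p ((2 * p * dB (2 * (p - 1)) - (p : ℚ) ^ 2 * dB (p - 1) ^ 2) / (p : ℚ) ^ 2)
      (-(V p 2 0 + V p 1 0 ^ 2)) := by
  have hp0 : (p : ℚ_[p]) ≠ 0 := by exact_mod_cast hpr.out.ne_zero
  have hp1 : (p : ℚ_[p]) - 1 ≠ 0 := by
    rw [sub_ne_zero]; exact_mod_cast hpr.out.ne_one
  obtain ⟨x, hx⟩ := sum_pow_mul_modEq_bernoulli hp (j := 1) one_ne_zero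
  obtain ⟨y, hy⟩ := sum_pow_mul_modEq_bernoulli hp (j := 2) two_ne_zero
  obtain ⟨w2, hw2, hw2'⟩ := exists_padic_half hp
  obtain ⟨i, hi, -⟩ := (Red.natCast (p := p) (p - 1)).inv
    (natCast_zmod_ne_zero (by omega) (by omega))
  rw [Rat.cast_inv, Rat.cast_natCast, Nat.cast_sub hpr.out.one_le, Nat.cast_one] at hi
  have hi1 : ((p : ℚ_[p]) - 1) * i = 1 := by rw [hi]; exact mul_inv_cancel₀ hp1
  rw [one_mul] at hx
  push_cast at hx hy
  have e1 : (p : ℚ_[p]) * ((dB (p - 1) : ℚ) : ℚ_[p]) =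
      1 + p * (U p 1 0 + (p - 2) * w2 * p * U p 2 0 + p ^ 2 * (i * x)) := by
    rw [dB, Rat.cast_div, Rat.cast_natCast, Nat.cast_sub hpr.out.one_le, Nat.cast_one,
      ← mul_div_assoc, hx, div_eq_iff hp1, hw2]
    linear_combination (-(p : ℚ_[p]) ^ 3 * x) * hi1
  have e2 : 2 * (p : ℚ_[p]) * ((dB (2 * (p - 1)) : ℚ) : ℚ_[p]) =
      1 + 2 * p * U p 1 0 + (2 * p - 3) * p ^ 2 * U p 2 0 + p ^ 3 * (i * y) := by
    rw [dB, Rat.cast_div, Rat.cast_natCast, Nat.cast_mul, Nat.cast_sub hpr.out.one_le,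
      Nat.cast_one, ← mul_div_assoc, div_eq_iff (by push_cast; exact mul_ne_zero two_ne_zero hp1)]
    push_cast
    linear_combination 2 * hy - 2 * (p : ℚ_[p]) ^ 3 * y * hi1
  -- Thus p 𝔅_{p-1} = 1 + p (U_1 + p A). In the difference the terms of order 1 and p cancel, and
  -- the coefficient of p^2 is -3U_2 + 2U_2 - U_1^2 modulo p.
  set A : ℤ_[p] := (p - 1 - 1) * w2 * U p 2 0 + p * (i * x) with hA
  refine ⟨(p + p - 1 - 1 - 1) * U p 2 0 + p * (i * y) - A - A - (U p 1 0 + p * A) ^ 2, ?_, ?_⟩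
  · rw [Rat.cast_div, eq_div_iff (by simpa using hp0)]
    push_cast
    have e3 : (p : ℚ_[p]) ^ 2 * ((dB (p - 1) : ℚ) : ℚ_[p]) ^ 2 =
      (1 + p * (U p 1 0 + (p - 2) * w2 * p * U p 2 0 + p ^ 2 * (i * x))) ^ 2 := by
      rw [← e1]; ring
    rw [e2, e3, hA]
    push_cast
    ring
  · have h2 := two_ne_zero_zmod hp
    simp [V, hA, hw2']
    field_simp
    ring

end PowerSums

/-! ### Third differences of Bernoulli numbers -/

section SecondCongruence

theorem not_dvd_add_mul {p m : ℕ} (j : ℕ) (h : ¬ (p - 1) ∣ m) : ¬ (p - 1) ∣ m + j * (p - 1) := by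
  rwa [Nat.dvd_add_left (dvd_mul_left _ _)]

variable {p : ℕ} [hpr : Fact p.Prime]

/-- The polynomial C(x,3) has constant third difference; the shifts x - j appear because m + j(p-1)
≡ m - j. -/
theorem third_difference_identity (hp : 7 ≤ p) (x v : ZMod p) :
    (x - 3) * (x - 3 - 1) * (x - 3 - 2) / 6 * v - 3 * ((x - 2) * (x - 2 - 1) * (x - 2 - 2) / 6 * v)
      + 3 * ((x - 1) * (x - 1 - 1) * (x - 1 - 2) / 6 * v) - x * (x - 1) * (x - 2) / 6 * v = -v := by
  have := six_ne_zero_zmod hp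
  field_simp
  ring

theorem cast_add_mul_sub_one (m j : ℕ) : ((m + j * (p - 1) : ℕ) : ZMod p) = m - j := by
  rw [Nat.cast_add, Nat.cast_mul, Nat.cast_sub hpr.out.one_le]
  simp
  ring

theorem V_add_mul (k m j : ℕ) : V p k (m + j * (p - 1)) = V p k m := by
  induction j with
  | zero => simp
  | succ j ih => rw [← ih]; exact V_add p k (by ring)

theorem red_bernoulli_third_difference (hp : 7 ≤ p) {m : ℕ} (h4 : 4 ≤ m) (hm : m ≤ p - 3)
    (he : Even m) :
    Red p ((p * bernoulli (m + 3 * (p - 1)) - 3 * p * bernoulli (m + 2 * (p - 1))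
      + 3 * p * bernoulli (m + (p - 1)) - p * bernoulli m) / (p : ℚ) ^ 3 - dB (m - 2))
      (-V p 3 m) := by
  have hp0 : (p : ℚ) ≠ 0 := by exact_mod_cast hpr.out.ne_zero
  have hd : ¬ (p - 1) ∣ m - 2 := not_dvd_of_lt (by omega) (by omega)
  have key : ∀ j : ℕ, Red p ((∑ a ∈ Icc 1 (p - 1), (a : ℚ) ^ (m + j * (p - 1))
      - p * bernoulli (m + j * (p - 1))) / (p : ℚ) ^ 3)
      (((m : ZMod p) - j) * (m - j - 1) * (m - j - 2) / 6 * V p 1 (m - 2)) := by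
    intro j
    have hs : m + j * (p - 1) - 2 = m - 2 + j * (p - 1) := by omega
    have h := sum_pow_even_modEq hp (m := m + j * (p - 1)) (by omega)
      (he.add ((even_prime_sub_one hp).mul_left j)) (by rw [hs]; exact not_dvd_add_mul j hd)
    rwa [hs, V_add_mul, cast_add_mul_sub_one] at h
  have h0 := key 0
  have h1 := key 1
  have h2 := key 2
  have h3 := key 3
  have hB := red_dB hp (by omega) (by rw [Nat.even_sub (by omega)]; simp [he]) hd
  have h := (((red_third_difference (p := p) m).sub
    (((h3.sub ((Red.ofNat 3).mul h2)).add ((Red.ofNat 3).mul h1)).sub h0))).sub hB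
  convert h using 1
  · simp only [one_mul, zero_mul, add_zero]
    field_simp
    ring
  · push_cast
    have h5 := third_difference_identity hp (m : ZMod p) (V p 1 (m - 2))
    rw [sub_zero]
    linear_combination h5

/-- At exponent 0 the power sum is exactly p-1, which replaces p B_0. The missing correction is
C(0,3) = 0, so the same difference identity applies at x = 0. -/
theorem red_bernoulli_third_difference_zero (hp : 7 ≤ p) :
    Red p ((p * bernoulli (3 * (p - 1)) - 3 * p * bernoulli (2 * (p - 1))
      + 3 * p * bernoulli (p - 1) - p + 1) / (p : ℚ) ^ 3 - dB (p - 3)) (-V p 3 0) := by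
  have hp0 : (p : ℚ) ≠ 0 := by exact_mod_cast hpr.out.ne_zero
  have hev := even_prime_sub_one hp
  have hd : ¬ (p - 1) ∣ p - 3 := not_dvd_of_lt (by omega) (by omega)
  have key : ∀ j : ℕ, Red p ((∑ a ∈ Icc 1 (p - 1), (a : ℚ) ^ (0 + (j + 1) * (p - 1))
      - p * bernoulli (0 + (j + 1) * (p - 1))) / (p : ℚ) ^ 3)
      (((0 : ZMod p) - (j + 1 : ℕ)) * (0 - (j + 1 : ℕ) - 1) * (0 - (j + 1 : ℕ) - 2) / 6
        * V p 1 (p - 3)) := by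
    intro j
    have hmul : (j + 1) * (p - 1) = j * (p - 1) + (p - 1) := by ring
    have hs : 0 + (j + 1) * (p - 1) - 2 = p - 3 + j * (p - 1) := by omega
    have h := sum_pow_even_modEq hp (m := 0 + (j + 1) * (p - 1)) (by omega)
      (by rw [zero_add]; exact hev.mul_left _) (by rw [hs]; exact not_dvd_add_mul j hd)
    rwa [hs, V_add_mul, cast_add_mul_sub_one, Nat.cast_zero] at h
  have h1 := key 0
  have h2 := key 1
  have h3 := key 2
  have he : Even (p - 3) := by
    obtain ⟨k, hk⟩ := hev
    exact ⟨k - 1, by omega⟩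
  have hB := red_dB hp (by omega) he hd
  have h := (((red_third_difference (p := p) 0).sub
    ((h3.sub ((Red.ofNat 3).mul h2)).add ((Red.ofNat 3).mul h1)))).sub hB
  convert h using 1
  · simp only [one_mul, zero_add, pow_zero, sum_const, Nat.card_Icc, Nat.add_sub_cancel,
      nsmul_eq_mul, mul_one, Nat.cast_sub hpr.out.one_le, Nat.reduceAdd, Nat.cast_one]
    field_simp
    ring
  · push_cast
    have h5 := third_difference_identity hp (0 : ZMod p) (V p 1 (p - 3))
    linear_combination h5

end SecondCongruence

/-! ### Convolution formulas for the second and third moments -/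

section FirstCongruence

variable {p : ℕ} [hpr : Fact p.Prime]

theorem red_dB_of_le (hp : 7 ≤ p) {i : ℕ} (h2 : 2 ≤ i) (hi : i ≤ p - 2) :
    Red p (dB i) (V p 1 i) := by
  rcases Nat.even_or_odd i with h | h
  · exact red_dB hp h2 h (not_dvd_of_lt (by omega) (by omega))
  · have h3 : 3 ≤ i := by obtain ⟨k, rfl⟩ := h; omega
    rw [dB_odd h (by omega), V_one_odd hp h3 hi h]
    exact Red.zero

theorem red_convB (hp : 7 ≤ p) :
    Red p (convB (p - 1)) (∑ i ∈ Icc 2 (p - 3), V p 1 i * V p 1 (p - 1 - i)) := by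
  rw [convB, show p - 1 - 2 = p - 3 by omega]
  refine Red.sum fun i hi => ?_
  rw [mem_Icc] at hi
  exact (red_dB_of_le hp (by omega) (by omega)).mul (red_dB_of_le hp (by omega) (by omega))

/-- Parseval's identity for the moments. -/
theorem V_two_zero (hp : 7 ≤ p) :
    V p 2 0 = -(V p 1 0 ^ 2 + ∑ i ∈ Icc 2 (p - 3), V p 1 i * V p 1 (p - 1 - i)) := by
  have hodd : Odd (p - 2) := by
    have := hpr.out.odd_of_ne_two (by omega)
    rw [Nat.odd_sub (by omega)]
    simp [this]
  have hz : V p 1 (p - 2) = 0 := V_one_odd hp (by omega) le_rfl hodd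
  rw [V_succ p 1 0, zero_add]
  obtain ⟨q, rfl⟩ : ∃ q, p = q + 3 := ⟨p - 3, by omega⟩
  simp only [show q + 3 - 1 = q + 2 by omega, show q + 3 - 2 = q + 1 by omega,
    show q + 3 - 3 = q by omega] at hz ⊢
  have hsum : ∑ i ∈ range (q + 1), V (q + 3) 1 i * V (q + 3) 1 (q + 2 - i) =
      V (q + 3) 1 0 * V (q + 3) 1 (q + 2) + V (q + 3) 1 1 * V (q + 3) 1 (q + 1) +
        ∑ i ∈ Icc 2 q, V (q + 3) 1 i * V (q + 3) 1 (q + 2 - i) := by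
    rw [range_eq_Ico, sum_eq_sum_Ico_succ_bot (by omega), sum_eq_sum_Ico_succ_bot (by omega),
      ← Ico_add_one_right_eq_Icc]
    simp only [Nat.sub_zero, zero_add, Nat.reduceAdd, show q + 2 - 1 = q + 1 by omega]
    ring
  rw [sum_range_succ, hsum, hz, V_add (q + 3) 1 (show q + 2 = 0 + (q + 3 - 1) by omega)]
  ring

/-- The boundary indices 0, 1 and M-2 are isolated because V_1(0), V_1(1) and V_2(2) are
exceptional; the indices M-1 and M-3 drop out by parity. -/
theorem sum_range_V_mul_V (hp : 7 ≤ p) {M : ℕ} (h4 : 4 ≤ M) (hM : M ≤ p - 1) (he : Even M) :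
    ∑ i ∈ range M, V p 1 i * V p 2 (M + (p - 1) - i) =
      V p 1 0 * V p 2 M - 1 / 2 * V p 1 (M - 2)
        + ∑ i ∈ Icc 2 (M - 4), V p 1 i * V p 2 (M - i) + V p 1 (M - 2) * V p 2 2 := by
  obtain ⟨K, rfl⟩ : ∃ K, M = K + 4 := ⟨M - 4, by omega⟩
  have hK : Even K := by
    rw [Nat.even_add] at he
    exact he.2 (by decide)
  have hper : ∀ i ∈ range (K + 4), V p 1 i * V p 2 (K + 4 + (p - 1) - i) =
      V p 1 i * V p 2 (K + 4 - i) := fun i hi => by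
    rw [mem_range] at hi
    rw [V_add p 2 (show K + 4 + (p - 1) - i = K + 4 - i + (p - 1) by omega)]
  have hodd : V p 1 (K + 3) = 0 := V_one_odd hp (by omega) (by omega) (hK.add_odd (by decide))
  have hV2 : V p 2 (K + 4 - 1) = V p 1 (K + 2) :=
    V_two_odd hp (by omega) (by omega) (hK.add_odd (by decide))
  have hsub : ∑ i ∈ Icc 2 K, V p 1 i * V p 2 (K + 4 - i) =
      ∑ i ∈ Ico 2 (K + 2), V p 1 i * V p 2 (K + 4 - i) := by
    refine sum_subset (fun i hi => ?_) fun i hi hi' => ?_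
    · rw [mem_Icc] at hi
      rw [mem_Ico]
      omega
    · rw [mem_Ico] at hi
      rw [mem_Icc] at hi'
      obtain rfl : i = K + 1 := by omega
      have : 3 ≤ K + 1 := by obtain ⟨k, rfl⟩ := hK; omega
      rw [V_one_odd hp this (by omega) hK.add_one, zero_mul]
  rw [sum_congr rfl hper, sum_range_succ, sum_range_succ, range_eq_Ico,
    sum_eq_sum_Ico_succ_bot (by omega), sum_eq_sum_Ico_succ_bot (by omega)]
  simp only [Nat.sub_zero, zero_add, Nat.reduceAdd, Nat.add_sub_cancel,
    show K + 4 - 2 = K + 2 by omega, show K + 4 - (K + 2) = 2 by omega]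
  rw [hsub, hodd, hV2, V_one_one hp]
  ring

theorem V_three_zero (hp : 7 ≤ p) :
    -V p 3 0 = V p 1 0 * V p 2 0 - 1 / 2 * V p 1 (p - 3)
      + ∑ i ∈ Icc 2 (p - 5), V p 1 i * V p 2 (p - 1 - i) + V p 1 (p - 3) * V p 2 2 := by
  have h := sum_range_V_mul_V hp (M := p - 1) (by omega) le_rfl (even_prime_sub_one hp)
  rw [← V_add p 3 (show p - 1 = 0 + (p - 1) by omega), V_succ p 2 (p - 1), neg_neg, h,
    V_add p 2 (show p - 1 = 0 + (p - 1) by omega)]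
  simp only [show p - 1 - 2 = p - 3 by omega, show p - 1 - 4 = p - 5 by omega]

theorem V_three (hp : 7 ≤ p) {M : ℕ} (h4 : 4 ≤ M) (hM : M ≤ p - 3) (he : Even M) :
    -V p 3 M = V p 1 0 * V p 2 M - 1 / 2 * V p 1 (M - 2)
      + ∑ i ∈ Icc 2 (M - 4), V p 1 i * V p 2 (M - i) + V p 1 (M - 2) * V p 2 2
      + V p 1 M * V p 2 0
      + ∑ i ∈ Icc (M + 2) (p - 3), V p 1 i * V p 2 (M + (p - 1) - i) := by
  have hev := even_prime_sub_one hp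
  have hsub : ∑ i ∈ Icc (M + 2) (p - 3), V p 1 i * V p 2 (M + (p - 1) - i) =
      ∑ i ∈ Ico (M + 2) (p - 1), V p 1 i * V p 2 (M + (p - 1) - i) := by
    refine sum_subset (fun i hi => ?_) fun i hi hi' => ?_
    · rw [mem_Icc] at hi
      rw [mem_Ico]
      omega
    · rw [mem_Ico] at hi
      rw [mem_Icc] at hi'
      have h1 : i = p - 1 - 1 := by omega
      have h2 : Odd i := by rw [h1]; exact Nat.Even.sub_odd (by omega) hev odd_one
      rw [V_one_odd hp (by omega) (by omega) h2, zero_mul]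
  rw [V_succ p 2 M, neg_neg, ← sum_range_add_sum_Ico _ (show M ≤ p - 1 by omega),
    sum_range_V_mul_V hp h4 (by omega) he, sum_eq_sum_Ico_succ_bot (show M < p - 1 by omega),
    sum_eq_sum_Ico_succ_bot (show M + 1 < p - 1 by omega), hsub,
    V_one_odd hp (show 3 ≤ M + 1 by omega) (by omega) he.add_one,
    V_add p 2 (show M + (p - 1) - M = 0 + (p - 1) by omega)]
  ring

theorem isPInt_dB_sub (hp : 7 ≤ p) {m : ℕ} (h4 : 4 ≤ m) (hm : m ≤ p - 2) :
    IsPInt p (dB (m + (p - 1)) - dB m) := by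
  rcases Nat.even_or_odd m with h | h
  · exact (red_dB_sub hp h4 h (not_dvd_of_lt (by omega) (by omega))
      (not_dvd_of_lt (by omega) (by omega))).hres.1
  · rw [dB_odd h (by omega), dB_odd (h.add_even (even_prime_sub_one hp)) (by omega), sub_self]
    exact Red.zero.isPInt

/-- For odd i the factor 𝔅_i vanishes, so nothing is needed about the digit; hence the parity
condition only for even i. -/
theorem red_dB_mul_hres (hp : 7 ≤ p) {i m : ℕ} (h2 : 2 ≤ i) (hi : i ≤ p - 2) (h4 : 4 ≤ m)
    (hm : m ≤ p - 2) (he : Even i → Even m) :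
    Red p (dB i * hres p (dB (m + (p - 1)) - dB m) 1) (V p 1 i * (-(1 / 2) * V p 2 m)) := by
  rcases Nat.even_or_odd i with h | h
  · exact (red_dB_of_le hp h2 hi).mul (red_dB_sub hp h4 (he h)
      (not_dvd_of_lt (by omega) (by omega)) (not_dvd_of_lt (by omega) (by omega))).hres.2
  · have h3 : 3 ≤ i := by obtain ⟨k, rfl⟩ := h; omega
    rw [dB_odd h (by omega), V_one_odd hp h3 hi h, zero_mul, zero_mul]
    exact Red.zero

/-- The functions `m` and `m'` absorb the different natural-subtraction forms of the indices in the
three sums. -/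
theorem red_sum_dB_mul_hres (hp : 7 ≤ p) {s : Finset ℕ} {M : ℕ} (he : Even M) (m m' : ℕ → ℕ)
    (hs : ∀ i ∈ s, 2 ≤ i ∧ i ≤ p - 2 ∧ i ≤ M ∧ m i = M - i ∧ 4 ≤ M - i ∧ M - i ≤ p - 2 ∧
      m' i = M - i + (p - 1)) :
    Red p (∑ i ∈ s, dB i * hres p (dB (m' i) - dB (m i)) 1)
      (-(1 / 2) * ∑ i ∈ s, V p 1 i * V p 2 (M - i)) := by
  rw [mul_sum]
  refine Red.sum fun i hi => ?_
  obtain ⟨h2, h3, h4, h5, h6, h7, h8⟩ := hs i hi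
  have h := red_dB_mul_hres hp h2 h3 h6 h7 (fun h => by
    rw [Nat.even_sub h4]
    exact ⟨fun _ => h, fun _ => he⟩)
  rw [h5, h8]
  convert h using 1
  ring

theorem red_first_zero (hp : 7 ≤ p) :
    Red p (-(1 + 2 * hres p (dB (p + 1) - dB 2) 1) * dB (p - 3)
        + wilsonQ p * (wilsonQ p ^ 2 + convB (p - 1))
        - 2 * ∑ k ∈ Icc 2 (p - 5), dB k * hres p (dB (2 * (p - 1) - k) - dB (p - 1 - k)) 1)
      (-V p 3 0) := by
  have hs := red_sum_dB_mul_hres hp (s := Icc 2 (p - 5)) (even_prime_sub_one hp)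
    (fun k => p - 1 - k) (fun k => 2 * (p - 1) - k) (fun i hi => by
      rw [mem_Icc] at hi
      omega)
  have h := ((((Red.one.add ((Red.ofNat 2).mul (red_dB_sub_two hp).hres.2)).neg).mul
    (red_dB_of_le hp (show 2 ≤ p - 3 by omega) (by omega))).add
    ((red_wilsonQ hp).mul (((red_wilsonQ hp).pow 2).add (red_convB hp)))).sub
    ((Red.ofNat 2).mul hs)
  convert h using 1
  have h2 := two_ne_zero_zmod hp
  have hV := V_two_zero hp
  have h4 : (4 : ZMod p) = 2 * 2 := by norm_num
  -- The factor 1 + 2(𝔅_{p+1} - 𝔅_2)_1 reduces to 1/2 - V_2(2), which accounts for both V_1(p-3)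
  -- terms.
  rw [V_three_zero hp, hV, h4]
  field_simp
  ring

theorem red_first (hp : 7 ≤ p) {n : ℕ} (hn : 2 ≤ 2 * n) (hn' : 2 * n ≤ p - 5) :
    Red p (-2 * ∑ i ∈ Icc 2 (p - 5 - 2 * n),
            dB i * hres p (dB (2 * (p - 1) - 2 * n - i) - dB (p - 1 - 2 * n - i)) 1
          + 2 * wilsonQ p * hres p (dB (2 * (p - 1) - 2 * n) - dB (p - 1 - 2 * n)) 1
          - (1 + 2 * hres p (dB (p + 1) - dB 2) 1) * dB (p - 3 - 2 * n)
          - (wilsonQ p ^ 2 + convB (p - 1)) * dB (p - 1 - 2 * n)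
          - 2 * ∑ i ∈ Icc (p + 1 - 2 * n) (p - 3),
            dB i * hres p (dB (3 * (p - 1) - 2 * n - i) - dB (2 * (p - 1) - 2 * n - i)) 1)
      (-V p 3 (p - 1 - 2 * n)) := by
  have hev := even_prime_sub_one hp
  have heM : Even (p - 1 - 2 * n) := by
    rw [Nat.even_sub (by omega)]
    simp [hev]
  have hs1 := red_sum_dB_mul_hres hp (s := Icc 2 (p - 5 - 2 * n)) heM
    (fun i => p - 1 - 2 * n - i) (fun i => 2 * (p - 1) - 2 * n - i) (fun i hi => by
      rw [mem_Icc] at hi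
      omega)
  have hs2 := red_sum_dB_mul_hres hp (s := Icc (p + 1 - 2 * n) (p - 3)) (heM.add hev)
    (fun i => 2 * (p - 1) - 2 * n - i) (fun i => 3 * (p - 1) - 2 * n - i) (fun i hi => by
      rw [mem_Icc] at hi
      omega)
  have hq := (red_dB_sub hp (show 4 ≤ p - 1 - 2 * n by omega) heM
    (not_dvd_of_lt (by omega) (by omega)) (not_dvd_of_lt (by omega) (by omega))).hres.2
  rw [show p - 1 - 2 * n + (p - 1) = 2 * (p - 1) - 2 * n by omega] at hq
  have h := ((((((Red.ofNat 2).neg.mul hs1).add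
    (((Red.ofNat 2).mul (red_wilsonQ hp)).mul hq)).sub
    ((Red.one.add ((Red.ofNat 2).mul (red_dB_sub_two hp).hres.2)).mul
    (red_dB_of_le hp (show 2 ≤ p - 3 - 2 * n by omega) (by omega)))).sub
    ((((red_wilsonQ hp).pow 2).add (red_convB hp)).mul
    (red_dB_of_le hp (show 2 ≤ p - 1 - 2 * n by omega) (by omega)))).sub
    ((Red.ofNat 2).mul hs2))
  convert h using 1
  have h2 := two_ne_zero_zmod hp
  have hV := V_two_zero hp
  have h4 : (4 : ZMod p) = 2 * 2 := by norm_num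
  rw [V_three hp (show 4 ≤ p - 1 - 2 * n by omega) (by omega) heM, hV, h4,
    show p - 1 - 2 * n - 2 = p - 3 - 2 * n by omega,
    show p - 1 - 2 * n - 4 = p - 5 - 2 * n by omega,
    show p - 1 - 2 * n + 2 = p + 1 - 2 * n by omega]
  field_simp
  ring

theorem red_second (hp : 7 ≤ p) {n : ℕ} (hn : 2 ≤ 2 * n) (hn' : 2 * n ≤ p - 5) :
    Red p ((p * bernoulli (4 * (p - 1) - 2 * n) - 3 * p * bernoulli (3 * (p - 1) - 2 * n)
            + 3 * p * bernoulli (2 * (p - 1) - 2 * n) - p * bernoulli (p - 1 - 2 * n))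
              / (p : ℚ) ^ 3
          - dB (p - 3 - 2 * n)) (-V p 3 (p - 1 - 2 * n)) := by
  have heM : Even (p - 1 - 2 * n) := by
    rw [Nat.even_sub (by omega)]
    simp [even_prime_sub_one hp]
  have h := red_bernoulli_third_difference hp (show 4 ≤ p - 1 - 2 * n by omega) (by omega) heM
  rwa [show p - 1 - 2 * n + 3 * (p - 1) = 4 * (p - 1) - 2 * n by omega,
    show p - 1 - 2 * n + 2 * (p - 1) = 3 * (p - 1) - 2 * n by omega,
    show p - 1 - 2 * n + (p - 1) = 2 * (p - 1) - 2 * n by omega,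
    show p - 1 - 2 * n - 2 = p - 3 - 2 * n by omega] at h

end FirstCongruence

end FermatQuotientSums

/-! ### Assembly of the congruences -/

open FermatQuotientSums

theorem theorem5 (p : ℕ) [Fact p.Prime] (hp : 7 ≤ p) :
    -- the general case
    (∀ n : ℕ, 2 ≤ 2 * n → 2 * n ≤ p - 5 →
      -- all the residues that occur are residues of `p`-adic integers
      (∀ i ∈ Icc 2 (p - 5 - 2 * n),
        IsPInt p (dB (2 * (p - 1) - 2 * n - i) - dB (p - 1 - 2 * n - i))) ∧
      IsPInt p (dB (2 * (p - 1) - 2 * n) - dB (p - 1 - 2 * n)) ∧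
      (∀ i ∈ Icc (p + 1 - 2 * n) (p - 3),
        IsPInt p (dB (3 * (p - 1) - 2 * n - i) - dB (2 * (p - 1) - 2 * n - i))) ∧
      -- first congruence
      CongrModP p (∑ a ∈ Icc 1 (p - 1), fermatQ p a ^ 3 / (a : ℚ) ^ (2 * n))
        (-2 * ∑ i ∈ Icc 2 (p - 5 - 2 * n),
            dB i * hres p (dB (2 * (p - 1) - 2 * n - i) - dB (p - 1 - 2 * n - i)) 1
          + 2 * wilsonQ p * hres p (dB (2 * (p - 1) - 2 * n) - dB (p - 1 - 2 * n)) 1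
          - (1 + 2 * hres p (dB (p + 1) - dB 2) 1) * dB (p - 3 - 2 * n)
          - (wilsonQ p ^ 2 + convB (p - 1)) * dB (p - 1 - 2 * n)
          - 2 * ∑ i ∈ Icc (p + 1 - 2 * n) (p - 3),
            dB i * hres p (dB (3 * (p - 1) - 2 * n - i) - dB (2 * (p - 1) - 2 * n - i)) 1) ∧
      -- second congruence
      CongrModP p (∑ a ∈ Icc 1 (p - 1), fermatQ p a ^ 3 / (a : ℚ) ^ (2 * n))
        ((p * bernoulli (4 * (p - 1) - 2 * n) - 3 * p * bernoulli (3 * (p - 1) - 2 * n)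
            + 3 * p * bernoulli (2 * (p - 1) - 2 * n) - p * bernoulli (p - 1 - 2 * n))
              / (p : ℚ) ^ 3
          - dB (p - 3 - 2 * n))) ∧
    -- the residue common to both cases
    IsPInt p (dB (p + 1) - dB 2) ∧
    -- the residues of the Wilson quotient and of the convolution
    CongrModP p (wilsonQ p) (agohGiugaQ p - 1) ∧
    IsPInt p (2 * p * dB (2 * (p - 1)) - (p : ℚ) ^ 2 * dB (p - 1) ^ 2) ∧
    CongrModP p (convB (p - 1))
      (hres p (2 * p * dB (2 * (p - 1)) - (p : ℚ) ^ 2 * dB (p - 1) ^ 2) 2) ∧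
    -- the case `2n = 0`
    (∀ k ∈ Icc 2 (p - 5), IsPInt p (dB (2 * (p - 1) - k) - dB (p - 1 - k))) ∧
    CongrModP p (∑ a ∈ Icc 1 (p - 1), fermatQ p a ^ 3)
      (-(1 + 2 * hres p (dB (p + 1) - dB 2) 1) * dB (p - 3)
        + wilsonQ p * (wilsonQ p ^ 2 + convB (p - 1))
        - 2 * ∑ k ∈ Icc 2 (p - 5), dB k * hres p (dB (2 * (p - 1) - k) - dB (p - 1 - k)) 1) ∧
    CongrModP p (∑ a ∈ Icc 1 (p - 1), fermatQ p a ^ 3)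
      ((p * bernoulli (3 * (p - 1)) - 3 * p * bernoulli (2 * (p - 1))
          + 3 * p * bernoulli (p - 1) - p + 1) / (p : ℚ) ^ 3
        - dB (p - 3)) := by
  have hcube : Red p (∑ a ∈ Icc 1 (p - 1), fermatQ p a ^ 3) (-V p 3 0) := by
    have h := red_sum_fermatQ_cube (p := p) (Nat.zero_le (p - 1))
    rw [V_add p 3 (show p - 1 - 0 = 0 + (p - 1) by omega)] at h
    simpa only [pow_zero, div_one] using h
  refine ⟨fun n hn hn' => ⟨fun i hi => ?_, ?_, fun i hi => ?_, ?_, ?_⟩,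
    (red_dB_sub_two hp).hres.1, (red_wilsonQ hp).congrModP (red_agohGiugaQ hp) rfl,
    (red_convolution_term hp).hres.1,
    (red_convB hp).congrModP (red_convolution_term hp).hres.2 ?_, fun k hk => ?_,
    hcube.congrModP (red_first_zero hp) rfl,
    hcube.congrModP (red_bernoulli_third_difference_zero hp) rfl⟩
  · rw [mem_Icc] at hi
    rw [show 2 * (p - 1) - 2 * n - i = p - 1 - 2 * n - i + (p - 1) by omega]
    exact isPInt_dB_sub hp (by omega) (by omega)
  · rw [show 2 * (p - 1) - 2 * n = p - 1 - 2 * n + (p - 1) by omega]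
    exact isPInt_dB_sub hp (by omega) (by omega)
  · rw [mem_Icc] at hi
    rw [show 3 * (p - 1) - 2 * n - i = 2 * (p - 1) - 2 * n - i + (p - 1) by omega]
    exact isPInt_dB_sub hp (by omega) (by omega)
  · exact (red_sum_fermatQ_cube (by omega)).congrModP (red_first hp hn hn') rfl
  · exact (red_sum_fermatQ_cube (by omega)).congrModP (red_second hp hn hn') rfl
  -- Parseval's identity turns the digit's residue -(V_2(0) + V_1(0)^2) into the convolution.
  · rw [V_two_zero hp]
    ring
  · rw [mem_Icc] at hk
    rw [show 2 * (p - 1) - k = p - 1 - k + (p - 1) by omega]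
    exact isPInt_dB_sub hp (by omega) (by omega)
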